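/- Let $G$ be a finite simple graph and let $\mathcal P=\{V_1,\dots,V_t\}$ be a partition of $V(G)$ into non-empty cliques of $G$ (a $1$-partition). Let $G_{\mathcal P}$ be the graph with vertex set $\mathcal P$ in which distinct $V_i,V_j$ are adjacent iff some edge of $G$ joins them, and suppose that $G_{\mathcal P}$ has maximum degree at most $\Delta$. For disjoint $A,B\subseteq V(G)$ let $E(A,B)$ be the set of edges of $G$ with one endpoint in $A$ and the other in $B$. *Canonical cycle covers.* A cycle cover of a graph is a set of pairwise vertex-disjoint cycles (each with at least three vertices) that together contain all its vertices; its size is the number of cycles. It is canonical with respect to a partition of the vertex set if (1) every part contains the whole vertex set of at most one of the cycles, and (2) for any two distinct parts $A,B$ at most one of the cycles uses edges of $E(A,B)$, and such a cycle uses at most two of them. *The sets $U_i$.* For every pair of neighbours $V_i,V_j$ in $G_{\mathcal P}$ choose an inclusion-maximal matching $M_{ij}\subseteq E(V_i,V_j)$ and a subset $M'_{ij}\subseteq M_{ij}$ with $|M'_{ij}|=\min\{6\Delta,|M_{ij}|\}$; let $L_i(j)$ and $L_j(i)$ be the sets of endpoints of $M'_{ij}$ in $V_i$ and $V_j$. If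 $|M_{ij}|\ge 6\Delta$, put $U_i(j)=L_i(j)$. If $|M_{ij}|<6\Delta$, let $U_i(j)$ be the union of $L_i(j)$ and, for each $v\in L_j(i)$, an arbitrarily chosen set of $\min\{|N(v)\cap V_i|,\,6\Delta-1\}$ neighbours of $v$ in $V_i$. (The set $U_j(i)$ is defined symmetrically.) Let $U_i^0=\bigcup_{V_j\in N(V_i)}U_i(j)$, and let $U_i$ be obtained from $U_i^0$ by adding $\min\{4\Delta+3,\,|V_i\setminus U_i^0|\}$ arbitrary vertices of $V_i\setminus U_i^0$. Let $U=\bigcup_i U_i$, $H=G[U]$ and $\mathcal P'=\{U_1,\dots,U_t\}$. **Theorem.** There is an absolute constant $c$ such that for all $G$, $\mathcal P$ and $\Delta$ as above and all choices made in the construction: 1. $U_i\subseteq V_i$ and $|U_i|\le c\cdot\max\{1,\Delta\}^3$ for every $i$; 2. for every integer $k\ge 0$, $G$ has a cycle cover of size exactly $k$ that is canonical with respect to $\mathcal P$ if and only if $H$ has a cycle cover of size exactly $k$ that is canonical with respect to $\mathcal P'$. -/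

import Mathlib

namespace CliqueCompress

universe u v

variable {V : Type u} {ι : Type v}

/-- `P` is a `κ`-partition of `G`: the `P i` partition the vertex set, every `G[P i]` is connected
(in particular `P i` is non-empty), and every `P i` is a union of at most `κ` cliques of `G`
(not necessarily disjoint; the empty clique is allowed in the family, hence "at most"). -/
structure IsKappaPartition (G : SimpleGraph V) (κ : ℕ) (P : ι → Set V) : Prop where
  disjoint : Pairwise fun i j => Disjoint (P i) (P j)
  cover : ⋃ i, P i = Set.univ
  connected : ∀ i, (G.induce (P i)).Connected
  cliques : ∀ i, ∃ K : Fin κ → Set V, (∀ a, G.IsClique (K a)) ∧ P i = ⋃ a, K a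

/-- The graph obtained by contracting every part to a vertex and removing loops and
multiple edges. -/
def partGraph (G : SimpleGraph V) (P : ι → Set V) : SimpleGraph ι where
  Adj i j := i ≠ j ∧ ∃ x ∈ P i, ∃ y ∈ P j, G.Adj x y
  symm := ⟨fun _ _ h => ⟨h.1.symm, by
    obtain ⟨x, hx, y, hy, hxy⟩ := h.2
    exact ⟨y, hy, x, hx, hxy.symm⟩⟩⟩
  loopless := ⟨fun _ h => h.1 rfl⟩

/-- `E(A, B)`: the edges of `G` with one endpoint in `A` and the other one in `B`. -/
def edgesBetween (G : SimpleGraph V) (A B : Set V) : Set (Sym2 V) :=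
  {e | ∃ x ∈ A, ∃ y ∈ B, G.Adj x y ∧ e = s(x, y)}

/-- The subgraph `C` of `G` is a cycle. -/
def IsCycleSubgraph {G : SimpleGraph V} (C : G.Subgraph) : Prop :=
  ∃ (x : V) (w : G.Walk x x), w.IsCycle ∧ w.toSubgraph = C

/-- A cycle cover: pairwise vertex disjoint cycles that together span all vertices. -/
structure IsCycleCover (G : SimpleGraph V) (𝒞 : Finset G.Subgraph) : Prop where
  isCycle : ∀ C ∈ 𝒞, IsCycleSubgraph C
  disjoint : ∀ C ∈ 𝒞, ∀ D ∈ 𝒞, C ≠ D → Disjoint C.verts D.verts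
  span : ∀ x : V, ∃ C ∈ 𝒞, x ∈ C.verts

/-- The two conditions on a set of cycles to be canonical with respect to `P`: at most one of the
cycles lies inside any given part; and for any two distinct parts at most one of the cycles has
edges between them, and at most two. -/
structure IsCanonical (G : SimpleGraph V) (P : ι → Set V) (𝒞 : Finset G.Subgraph) : Prop where
  inside : ∀ i, ∀ C ∈ 𝒞, ∀ D ∈ 𝒞, C.verts ⊆ P i → D.verts ⊆ P i → C = D
  across : ∀ i j, i ≠ j → ∀ C ∈ 𝒞, ∀ D ∈ 𝒞,
    (edgesBetween G (P i) (P j) ∩ C.edgeSet).Nonempty →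
    (edgesBetween G (P i) (P j) ∩ D.edgeSet).Nonempty → C = D
  across_le : ∀ i j, i ≠ j → ∀ C ∈ 𝒞, (edgesBetween G (P i) (P j) ∩ C.edgeSet).ncard ≤ 2

/-- `G` has a cycle cover of size exactly `k` that is canonical with respect to `P`. -/
def HasCanonicalCycleCover (G : SimpleGraph V) (P : ι → Set V) (k : ℕ) : Prop :=
  ∃ 𝒞 : Finset G.Subgraph, IsCycleCover G 𝒞 ∧ IsCanonical G P 𝒞 ∧ 𝒞.card = k

/-- A set of edges no two of which share an endpoint. -/
def IsMatchingSet (M : Set (Sym2 V)) : Prop :=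
  ∀ e ∈ M, ∀ f ∈ M, ∀ x, x ∈ e → x ∈ f → e = f

/-- The endpoints in `A` of the edges in `M`. -/
def endpointsIn (M : Set (Sym2 V)) (A : Set V) : Set V :=
  {x | x ∈ A ∧ ∃ e ∈ M, x ∈ e}

/-- The arbitrary choices made while the sets `U i` are built. For neighbouring parts `P i`, `P j`:
a maximal matching `M i j` between them, a subset `M' i j` of it of size `min (6 Δ) |M i j|`,
and, for every `y` that is an endpoint of `M' i j` in `P j`, a set `nbrs i j y` of
`min |N(y) ∩ P i| (6 Δ - 1)` neighbours of `y` in `P i`. -/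
structure MatchingChoice (G : SimpleGraph V) (P : ι → Set V) (Δ : ℕ) where
  M : ι → ι → Set (Sym2 V)
  M' : ι → ι → Set (Sym2 V)
  nbrs : ι → ι → V → Set V
  M_symm : ∀ i j, M i j = M j i
  M'_symm : ∀ i j, M' i j = M' j i
  M_maximal : ∀ i j, (partGraph G P).Adj i j →
    Maximal (fun N => N ⊆ edgesBetween G (P i) (P j) ∧ IsMatchingSet N) (M i j)
  M'_subset : ∀ i j, (partGraph G P).Adj i j → M' i j ⊆ M i j
  M'_ncard : ∀ i j, (partGraph G P).Adj i j → (M' i j).ncard = min (6 * Δ) (M i j).ncard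
  nbrs_subset : ∀ i j, (partGraph G P).Adj i j → ∀ y ∈ endpointsIn (M' i j) (P j),
    nbrs i j y ⊆ G.neighborSet y ∩ P i
  nbrs_ncard : ∀ i j, (partGraph G P).Adj i j → ∀ y ∈ endpointsIn (M' i j) (P j),
    (nbrs i j y).ncard = min (G.neighborSet y ∩ P i).ncard (6 * Δ - 1)

namespace MatchingChoice

variable {G : SimpleGraph V} {P : ι → Set V} {Δ : ℕ}

/-- The set `U_i(j) ⊆ P i` attached to the neighbouring parts `P i`, `P j`: the endpoints of
`M' i j` in `P i` and, if `|M i j| < 6 Δ`, also the chosen neighbours of the endpoints of `M' i j`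
in `P j`. -/
def pairSet (S : MatchingChoice G P Δ) (i j : ι) : Set V :=
  {x | x ∈ endpointsIn (S.M' i j) (P i) ∨
    ((S.M i j).ncard < 6 * Δ ∧ ∃ y ∈ endpointsIn (S.M' i j) (P j), x ∈ S.nbrs i j y)}

/-- The union of the sets `U_i(j)` over the neighbours `P j` of `P i`. -/
def core (S : MatchingChoice G P Δ) (i : ι) : Set V :=
  {x | ∃ j, (partGraph G P).Adj i j ∧ x ∈ S.pairSet i j}

end MatchingChoice

/-- All choices: those of `MatchingChoice`, and for every `i` a set `extra i` of
`min (4 Δ + 3) |P i \ core i|` further vertices of `P i`. -/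
structure Selection (G : SimpleGraph V) (P : ι → Set V) (Δ : ℕ) extends
    MatchingChoice G P Δ where
  extra : ι → Set V
  extra_subset : ∀ i, extra i ⊆ P i \ toMatchingChoice.core i
  extra_ncard : ∀ i, (extra i).ncard = min (4 * Δ + 3) (P i \ toMatchingChoice.core i).ncard

namespace Selection

variable {G : SimpleGraph V} {P : ι → Set V} {Δ : ℕ}

/-- The selected set `U_i`. -/
def U (S : Selection G P Δ) (i : ι) : Set V :=
  S.toMatchingChoice.core i ∪ S.extra i

/-- The vertex set `U = ⋃ i, U_i`. -/
def verts (S : Selection G P Δ) : Set V := ⋃ i, S.U i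

/-- The graph `H = G[U]`. -/
def H (S : Selection G P Δ) : SimpleGraph S.verts := G.induce S.verts

/-- The partition `{U_i}` of the vertex set of `H`. -/
def P' (S : Selection G P Δ) (i : ι) : Set S.verts := {x | (x : V) ∈ S.U i}

end Selection

end CliqueCompress

/-! ### Permutations as families of oriented cycles. -/

namespace CliqueCompress

open Equiv Equiv.Perm

universe u v

variable {V : Type u} {ι : Type v}

/-! A cycle cover is encoded by the permutation sending each vertex to its successor. Parts are
cliques, so successive vertices in the same part are automatically adjacent: whether the permutation
runs along edges of `G` is decided by its crossing edges (`cross`) alone. Apart from the absence of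
2-cycles, being canonical with `k` cycles (`IsShape`) depends only on the parts that the cycles
visit and join. Vertices may therefore be rearranged inside their parts by three moves: inserting a
fixed vertex (`IsShape.insert_after`), bypassing a vertex on no crossing edge (`IsShape.remove`),
and relocating the start of a crossing edge (`IsShape.move`; its end, after reversal). Bypassing
would turn a triangle into a 2-cycle; in that case the vertex first trades places with one on
another cycle, which is longer because only one cycle may lie inside the part.

Canonicity leaves at most `2 * Δ` endpoints of crossing edges in each part
(`IsShape.ncard_inter_ends_le`), so the selected vertices offer room. For a large matching, some
selected matching edge avoids all these endpoints. A small matching is kept whole, and by maximality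
every edge between the two parts has a matched endpoint; that endpoint stays, and the other one is
selected already or can be exchanged for one of `6 * Δ - 1` selected neighbours
(`MatchingChoice.exists_replacement`).

From `G` to `H`, crossing edges are pushed into `U` one by one (`IsShape.exists_cross_subset`), and
then the vertices outside `U` are bypassed (`IsShape.exists_support_eq`). From `H` to `G`, the
missing vertices are inserted (`IsShape.exists_full`). A part with a vertex outside `U` has at least
`4 * Δ + 3` selected vertices, so a selected one on no crossing edge is always available. -/

/-- A permutation, read as a family of disjoint oriented cycles on its non-fixed points, has the
combinatorial shape of a canonical family of `k` cycles with respect to the part function `p`. -/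
structure IsShape (R : SimpleGraph ι) (p : V → ι) (k : ℕ) (σ : Perm V) : Prop where
  no_two : ∀ x, σ x ≠ x → σ (σ x) ≠ x
  color : ∃ c : V → Fin k, (∀ a, ∃ x, σ x ≠ x ∧ c x = a) ∧
    ∀ x y, σ x ≠ x → σ y ≠ y → (c x = c y ↔ σ.SameCycle x y)
  inside : ∀ x y, σ x ≠ x → σ y ≠ y → (∀ z, σ.SameCycle x z → p z = p x) →
    (∀ z, σ.SameCycle y z → p z = p y) → p x = p y → σ.SameCycle x y
  across : ∀ x y, p x ≠ p (σ x) → s(p x, p (σ x)) = s(p y, p (σ y)) → σ.SameCycle x y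
  across_le : ∀ e : Sym2 ι, ¬ e.IsDiag → {x | s(p x, p (σ x)) = e}.ncard ≤ 2
  adj : ∀ x, p x ≠ p (σ x) → R.Adj (p x) (p (σ x))

/-- The oriented edges of a permutation which leave a part. -/
def cross (p : V → ι) (σ : Perm V) : Set (V × V) :=
  {q | σ q.1 = q.2 ∧ p q.1 ≠ p q.2}

/-- The endpoints of a set of oriented edges. -/
def ends (X : Set (V × V)) : Set V := {x | ∃ q ∈ X, q.1 = x ∨ q.2 = x}

variable {R : SimpleGraph ι} {p : V → ι} {k : ℕ} {σ σ' : Perm V}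

lemma notMem_ends_cross {x : V} :
    x ∉ ends (cross p σ) ↔ p (σ x) = p x ∧ p (σ⁻¹ x) = p x := by
  constructor
  · intro h
    constructor
    · by_contra hne
      exact h ⟨(x, σ x), ⟨rfl, fun h' => hne h'.symm⟩, Or.inl rfl⟩
    · by_contra hne
      exact h ⟨(σ⁻¹ x, x), ⟨by simp, hne⟩, Or.inr rfl⟩
  · rintro ⟨h1, h2⟩ ⟨⟨a, b⟩, ⟨hab, hp⟩, h⟩
    dsimp at hab hp h
    subst hab
    rcases h with rfl | rfl
    · exact hp h1.symm
    · exact hp (by simpa using h2)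

lemma SameCycle.rel {E : V → V → Prop} (hE : Equivalence E) (h : ∀ a, E a (σ a)) {x y : V}
    (hxy : σ.SameCycle x y) : E x y := by
  obtain ⟨n, rfl⟩ := hxy
  induction n with
  | zero => simpa using hE.refl x
  | succ n ih =>
    have : (σ ^ ((n : ℤ) + 1)) x = σ ((σ ^ (n : ℤ)) x) := by
      rw [add_comm, zpow_add, zpow_one, Perm.mul_apply]
    rw [this]
    exact hE.trans ih (h _)
  | pred n ih =>
    have : (σ ^ (-(n : ℤ))) x = σ ((σ ^ (-(n : ℤ) - 1)) x) := by
      rw [← Perm.mul_apply, ← zpow_one_add]; congr 2; ring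
    rw [this] at ih
    exact hE.trans ih (hE.symm (h _))

/-- The common criterion behind all moves. `r` matches the nontrivial cycles of `σ'` with those of
`σ` and respects the parts they visit; `t` reindexes the oriented edges without changing their pair
of parts. The shape sees nothing else except 2-cycles, which are therefore excluded separately. -/
lemma IsShape.transfer (h : IsShape R p k σ) (hno : ∀ x, σ' x ≠ x → σ' (σ' x) ≠ x)
    (r : V → V) (t : Perm V)
    (hr : ∀ x, σ' x ≠ x → σ (r x) ≠ r x ∧ p (r x) = p x)
    (hsurj : ∀ y, σ y ≠ y → ∃ x, σ' x ≠ x ∧ σ.SameCycle (r x) y ∧ p x = p y)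
    (hsame : ∀ x y, σ' x ≠ x → σ' y ≠ y → (σ'.SameCycle x y ↔ σ.SameCycle (r x) (r y)))
    (ht : ∀ a, s(p a, p (σ' a)) = s(p (t a), p (σ (t a))))
    (htr : ∀ a, p a ≠ p (σ' a) → σ.SameCycle (t a) (r a)) : IsShape R p k σ' := by
  have hcr : ∀ a, p a ≠ p (σ' a) ↔ p (t a) ≠ p (σ (t a)) := fun a => by
    rw [← not_iff_not]
    simpa using (congrArg Sym2.IsDiag (ht a)).to_iff
  have mono : ∀ x, σ' x ≠ x → (∀ z, σ'.SameCycle x z → p z = p x) →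
      ∀ z, σ.SameCycle (r x) z → p z = p (r x) := by
    intro x hx hm z hz
    have hz' : σ z ≠ z := fun e => (hr x hx).1 (hz.apply_eq_self_iff.2 e)
    obtain ⟨w, hw, hwz, hpw⟩ := hsurj z hz'
    rw [← hpw, (hr x hx).2]
    exact hm w ((hsame x w hx hw).2 (hz.trans hwz.symm))
  refine ⟨hno, ?_, ?_, ?_, ?_, ?_⟩
  · obtain ⟨c, hc, hcs⟩ := h.color
    refine ⟨fun x => c (r x), fun a => ?_, fun x y hx hy => ?_⟩
    · obtain ⟨y, hy, rfl⟩ := hc a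
      obtain ⟨x, hx, hxy, -⟩ := hsurj y hy
      exact ⟨x, hx, (hcs _ _ (hr x hx).1 hy).2 hxy⟩
    · rw [hcs _ _ (hr x hx).1 (hr y hy).1, hsame x y hx hy]
  · intro x y hx hy hmx hmy hxy
    rw [hsame x y hx hy]
    refine h.inside _ _ (hr x hx).1 (hr y hy).1 (mono x hx hmx) (mono y hy hmy) ?_
    rw [(hr x hx).2, (hr y hy).2, hxy]
  · intro x y hx hxy
    have hy : p y ≠ p (σ' y) := by
      have := (congrArg Sym2.IsDiag hxy).to_iff
      simp only [Sym2.mk_isDiag_iff] at this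
      exact fun e => hx (this.2 e)
    have ne : ∀ z, p z ≠ p (σ' z) → σ' z ≠ z := fun z hz e => hz (by rw [e])
    rw [hsame x y (ne x hx) (ne y hy)]
    refine (htr x hx).symm.trans (SameCycle.trans ?_ (htr y hy))
    exact h.across _ _ ((hcr x).1 hx) (by rw [← ht, ← ht, hxy])
  · intro e he
    refine le_trans (le_of_eq ?_) (h.across_le e he)
    rw [← Set.ncard_image_of_injective _ t.injective]
    congr 1
    ext y
    constructor
    · rintro ⟨x, hx, rfl⟩
      exact (ht x).symm.trans hx
    · intro hy
      refine ⟨t.symm y, ?_, by simp⟩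
      have := ht (t.symm y)
      rw [t.apply_symm_apply] at this
      exact this.trans hy
  · intro x hx
    have h1 : s(p (t x), p (σ (t x))) ∈ R.edgeSet := h.adj _ ((hcr x).1 hx)
    rw [← ht] at h1
    exact h1

/-- Reversing all orientations makes every move on starts of edges available for their ends. -/
lemma IsShape.inv (h : IsShape R p k σ) : IsShape R p k σ⁻¹ := by
  have hf : ∀ x, σ⁻¹ x ≠ x ↔ σ x ≠ x := fun x => by
    rw [Ne, Ne, Perm.inv_eq_iff_eq, eq_comm]
  refine h.transfer ?_ id σ⁻¹ ?_ ?_ ?_ ?_ ?_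
  · intro x hx e
    rw [Perm.inv_eq_iff_eq, Perm.inv_eq_iff_eq] at e
    exact h.no_two x ((hf x).1 hx) e.symm
  · intro x hx
    exact ⟨(hf x).1 hx, rfl⟩
  · intro y hy
    exact ⟨y, (hf y).2 hy, SameCycle.rfl, rfl⟩
  · intro x y _ _
    simp
  · intro a
    simp [Sym2.eq_swap]
  · intro a _
    simp [SameCycle.refl]

lemma cross_inv : cross p σ⁻¹ = Prod.swap '' cross p σ := by
  ext ⟨a, b⟩
  simp only [cross, Set.mem_ofPred_eq, Set.mem_image, Prod.exists, Prod.swap_prod_mk, Prod.mk.injEq]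
  constructor
  · rintro ⟨h1, h2⟩
    exact ⟨b, a, ⟨by rw [← h1]; simp, h2.symm⟩, rfl, rfl⟩
  · rintro ⟨_, _, ⟨h1, h2⟩, rfl, rfl⟩
    exact ⟨by rw [← h1]; simp, h2.symm⟩

lemma ends_swap (X : Set (V × V)) : ends (Prod.swap '' X) = ends X := by
  ext x
  simp only [ends, Set.mem_image, Prod.exists, Set.mem_ofPred_eq, Prod.swap_prod_mk, Prod.mk.injEq]
  constructor
  · rintro ⟨_, _, ⟨a, b, h, rfl, rfl⟩, h'⟩
    exact ⟨a, b, h, h'.symm⟩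
  · rintro ⟨a, b, h, h'⟩
    exact ⟨b, a, ⟨a, b, h, rfl, rfl⟩, h'.symm⟩

lemma IsShape.conj (h : IsShape R p k σ) (s : Perm V) (hs : ∀ x, p (s x) = p x) :
    IsShape R p k (s * σ * s⁻¹) := by
  have hs' : ∀ x, p (s⁻¹ x) = p x := fun x => by rw [← hs (s⁻¹ x)]; simp
  have hf : ∀ x, (s * σ * s⁻¹) x ≠ x ↔ σ (s⁻¹ x) ≠ s⁻¹ x := fun x => by
    simp only [Perm.mul_apply]
    rw [Ne, Ne, ← Perm.eq_inv_iff_eq]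
  refine h.transfer ?_ (fun x => s⁻¹ x) s⁻¹ ?_ ?_ ?_ ?_ ?_
  · intro x hx e
    refine h.no_two _ ((hf x).1 hx) ?_
    simp only [Perm.mul_apply] at e
    rw [← Perm.eq_inv_iff_eq] at e
    simpa using e
  · intro x hx
    exact ⟨(hf x).1 hx, hs' x⟩
  · intro y hy
    exact ⟨s y, by rw [hf]; simpa using hy, by simp [SameCycle.refl], hs y⟩
  · intro x y _ _
    exact sameCycle_conj
  · intro a
    rw [hs', Perm.mul_apply, Perm.mul_apply, hs]
  · intro a _
    exact SameCycle.refl _ _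

/-! ### Local moves: insertion, bypass, exchange and relocation. -/

section Insert

variable [DecidableEq V]

/-- For a fixed `v`, the product reroutes `x ↦ σ x` as `x ↦ v ↦ σ x`. Collapsing `v` back onto `x`
recovers the old cycles. -/
lemma sameCycle_mul_swap {x v : V} (hv : σ v = v) (hxv : x ≠ v) (y z : V) :
    (σ * swap x v).SameCycle y z ↔
      σ.SameCycle (Function.update id v x y) (Function.update id v x z) := by
  set σ' := σ * swap x v with hσ'
  have ex : σ' x = v := by simp [hσ', hv]
  have ev : σ' v = σ x := by simp [hσ']
  have eo : ∀ a, a ≠ x → a ≠ v → σ' a = σ a := fun a h1 h2 => by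
    simp [hσ', swap_apply_of_ne_of_ne h1 h2]
  have inj : ∀ a, a ≠ v → σ a ≠ v := fun a ha e => ha (σ.injective (e.trans hv.symm))
  set r := Function.update id v x with hr
  have rv : r v = x := by simp [hr]
  have ro : ∀ a, a ≠ v → r a = a := fun a ha => by simp [hr, ha]
  constructor
  · refine SameCycle.rel (E := fun a b => σ.SameCycle (r a) (r b))
      ⟨fun _ => SameCycle.refl _ _, fun h => h.symm, fun h h' => h.trans h'⟩ fun a => ?_
    by_cases hax : a = x
    · subst hax
      rw [ex, rv, ro _ hxv]
    · by_cases hav : a = v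
      · subst hav
        rw [ev, rv, ro _ (inj x hxv)]
        exact (sameCycle_apply_right.2 (SameCycle.refl _ _))
      · rw [eo a hax hav, ro _ hav, ro _ (inj a hav)]
        exact (sameCycle_apply_right.2 (SameCycle.refl _ _))
  · intro h
    have h1 : σ'.SameCycle (r y) (r z) := by
      refine SameCycle.rel (E := fun a b => σ'.SameCycle a b) (SameCycle.equivalence σ')
        (fun a => ?_) h
      by_cases hax : a = x
      · subst hax
        rw [← ev, sameCycle_apply_right, ← ex, sameCycle_apply_right]
      · by_cases hav : a = v
        · rw [hav, hv]
        · rw [← eo a hax hav]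
          exact (sameCycle_apply_right.2 (SameCycle.refl _ _))
    have h2 : ∀ a, σ'.SameCycle a (r a) := fun a => by
      by_cases hav : a = v
      · subst hav
        rw [rv]
        conv => arg 2; rw [← ex]
        exact sameCycle_apply_left.2 (SameCycle.refl _ _)
      · rw [ro a hav]
    exact (h2 y).trans (h1.trans (h2 z).symm)

lemma apply_mul_swap_ne_iff {x v : V} (hv : σ v = v) (hx : σ x ≠ x) (a : V) :
    (σ * swap x v) a ≠ a ↔ σ a ≠ a ∨ a = v := by
  have hxv : x ≠ v := fun e => hx (e ▸ hv)
  by_cases hax : a = x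
  · subst hax
    simp [hv, hx, hxv.symm]
  · by_cases hav : a = v
    · subst hav
      have : σ x ≠ a := fun e => hxv (σ.injective (e.trans hv.symm))
      simp [this]
    · simp [swap_apply_of_ne_of_ne hax hav, hav]

lemma p_swap_apply {x v : V} (hp : p x = p v) (a : V) : p (swap x v a) = p a := by
  by_cases hax : a = x
  · subst hax; simp [hp]
  · by_cases hav : a = v
    · subst hav; simp [hp]
    · rw [swap_apply_of_ne_of_ne hax hav]

/-- The edge that left `x` now leaves `v`, which is in the same part, and the new edge from `x` to
`v` stays inside; so `swap x v` serves as the reindexing of edges. Cycles only get longer, so no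
2-cycle arises. -/
lemma IsShape.insert_after (h : IsShape R p k σ) {x v : V} (hv : σ v = v) (hx : σ x ≠ x)
    (hp : p x = p v) : IsShape R p k (σ * swap x v) := by
  have hxv : x ≠ v := fun e => hx (e ▸ hv)
  have hf := apply_mul_swap_ne_iff hv hx
  have inj : ∀ a, a ≠ v → σ a ≠ v := fun a ha e => ha (σ.injective (e.trans hv.symm))
  refine h.transfer ?_ (Function.update id v x) (swap x v) ?_ ?_ ?_ ?_ ?_
  · intro a ha
    rw [hf] at ha
    by_cases hax : a = x
    · subst hax
      simpa [hv] using hx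
    · by_cases hav : a = v
      · subst hav
        by_cases h2 : σ x = x
        · exact absurd h2 hx
        · simp only [Perm.mul_apply, swap_apply_right]
          rw [swap_apply_of_ne_of_ne h2 (inj x hxv)]
          exact inj _ (inj x hxv)
      · have ha' := ha.resolve_right hav
        simp only [Perm.mul_apply, swap_apply_of_ne_of_ne hax hav]
        by_cases h2 : σ a = x
        · rw [h2, swap_apply_left, hv]; exact Ne.symm hav
        · rw [swap_apply_of_ne_of_ne h2 (inj a hav)]
          exact h.no_two a ha'
  · intro a ha
    by_cases hav : a = v
    · subst hav; simp [hx, hp]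
    · simpa [hav] using ((hf a).1 ha).resolve_right hav
  · intro y hy
    have : y ≠ v := fun e => hy (by rw [e, hv])
    exact ⟨y, (hf y).2 (Or.inl hy), by simp [this, SameCycle.refl], rfl⟩
  · intro a b _ _
    exact sameCycle_mul_swap hv hxv a b
  · intro a
    rw [p_swap_apply hp, Perm.mul_apply]
  · intro a ha
    by_cases hax : a = x
    · subst hax; simp [hv, hp] at ha
    · by_cases hav : a = v
      · subst hav; simp [SameCycle.refl]
      · simp [swap_apply_of_ne_of_ne hax hav, hav, SameCycle.refl]

lemma cross_mul_swap {x v : V} (hp : p x = p v) :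
    cross p (σ * swap x v) = (fun q => (swap x v q.1, q.2)) '' cross p σ := by
  ext ⟨a, b⟩
  simp only [cross, Set.mem_ofPred_eq, Set.mem_image, Prod.exists, Prod.mk.injEq, Perm.mul_apply]
  constructor
  · rintro ⟨h1, h2⟩
    exact ⟨swap x v a, b, ⟨h1, by rwa [p_swap_apply hp]⟩, by simp, rfl⟩
  · rintro ⟨a', b', ⟨h1, h2⟩, rfl, rfl⟩
    exact ⟨by simpa using h1, by rwa [p_swap_apply hp]⟩

/-- A vertex inside a part that lies on a cycle with at least four vertices can be bypassed. -/
lemma IsShape.remove_of_long (h : IsShape R p k σ) {v : V} (hv : σ v ≠ v)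
    (h3 : σ (σ (σ v)) ≠ v) (hend : v ∉ ends (cross p σ)) :
    IsShape R p k (σ * swap (σ⁻¹ v) v) ∧ cross p (σ * swap (σ⁻¹ v) v) = cross p σ ∧
      ∀ a, (σ * swap (σ⁻¹ v) v) a ≠ a ↔ σ a ≠ a ∧ a ≠ v := by
  obtain ⟨hp1, hp2⟩ := notMem_ends_cross.1 hend
  obtain ⟨u, rfl⟩ : ∃ u, v = σ u := ⟨σ⁻¹ v, by simp⟩
  have hinv : σ⁻¹ (σ u) = u := by simp
  rw [hinv] at hp2 ⊢
  set v := σ u with hvdef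
  have huv : u ≠ v := fun e => hv (by rw [← e, ← hvdef, e])
  have hvu : σ v ≠ u := fun e => by
    refine h.no_two u (fun e' => huv (e'.symm.trans hvdef.symm)) ?_
    rw [← hvdef]; exact e
  set τ := σ * swap u v with hτ
  have tv : τ v = v := by simp [hτ, hvdef]
  have tu : τ u = σ v := by simp [hτ]
  have hto : ∀ a, a ≠ u → a ≠ v → τ a = σ a := fun a h1 h2 => by
    simp [hτ, swap_apply_of_ne_of_ne h1 h2]
  -- Bypassing is inverse to inserting: `σ` arises from `τ` by inserting `v` after `u`, so the
  -- insertion lemmas are read backwards.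
  have hστ : τ * swap u v = σ := by rw [hτ, mul_assoc, swap_mul_self, mul_one]
  have hf : ∀ a, τ a ≠ a ↔ σ a ≠ a ∧ a ≠ v := by
    have hτu : τ u ≠ u := by rw [tu]; exact hvu
    intro a
    have := apply_mul_swap_ne_iff tv hτu a
    rw [hστ] at this
    rw [this]
    constructor
    · intro ha
      exact ⟨Or.inl ha, fun e => ha (by rw [e, tv])⟩
    · rintro ⟨h1 | h1, h2⟩
      · exact h1
      · exact absurd h1 h2
  have inj : ∀ a, a ≠ u → σ a ≠ v := fun a ha e => ha (σ.injective e)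
  refine ⟨?_, ?_, hf⟩
  · refine h.transfer ?_ id (swap u v) ?_ ?_ ?_ ?_ ?_
    · intro a ha
      obtain ⟨ha1, ha2⟩ := (hf a).1 ha
      by_cases hau : a = u
      · subst hau
        rw [tu, hto _ hvu hv]
        intro e
        exact h3 (by rw [e])
      · rw [hto a hau ha2]
        by_cases h2 : σ a = u
        · rw [h2, tu]
          intro e
          refine h3 ?_
          rw [e, h2]
        · rw [hto _ h2 (inj a hau)]
          exact h.no_two a ha1
    · intro x hx
      exact ⟨((hf x).1 hx).1, rfl⟩
    · intro y hy
      -- The lost vertex `v` is represented by its successor, which lies in the same part because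
      -- `v` is on no crossing edge.
      by_cases hyv : y = v
      · refine ⟨σ v, (hf _).2 ⟨fun e => hv (σ.injective e), hv⟩, ?_, by rw [hyv, hp1]⟩
        rw [hyv]
        exact sameCycle_apply_left.2 (SameCycle.refl _ _)
      · exact ⟨y, (hf y).2 ⟨hy, hyv⟩, SameCycle.refl _ _, rfl⟩
    · intro x y hx hy
      have := sameCycle_mul_swap tv huv x y
      rw [hστ] at this
      simp only [id]
      rw [this]
      simp [((hf x).1 hx).2, ((hf y).1 hy).2]
    · intro a
      rw [p_swap_apply hp2, hτ, Perm.mul_apply]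
    · intro a ha
      by_cases hau : a = u
      · subst hau
        rw [swap_apply_left, hvdef]
        exact sameCycle_apply_left.2 (SameCycle.refl _ _)
      · have hav : a ≠ v := fun e => ha (by rw [e, tv])
        simp [swap_apply_of_ne_of_ne hau hav, SameCycle.refl]
  · ext ⟨a, b⟩
    simp only [cross, Set.mem_ofPred_eq]
    by_cases hau : a = u
    · subst hau
      rw [tu]
      constructor
      · rintro ⟨rfl, h2⟩; exact absurd (hp2.trans hp1.symm) h2
      · rintro ⟨h1, h2⟩; rw [← h1] at h2; exact absurd hp2 h2
    · by_cases hav : a = v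
      · subst hav
        rw [tv]
        constructor
        · rintro ⟨rfl, h2⟩; exact absurd rfl h2
        · rintro ⟨rfl, h2⟩; exact absurd hp1.symm h2
      · rw [hto a hau hav]

lemma cross_conj_swap {v w : V} (hp : p v = p w) :
    cross p (swap v w * σ * (swap v w)⁻¹) = Prod.map (swap v w) (swap v w) '' cross p σ := by
  ext ⟨a, b⟩
  simp only [cross, Set.mem_ofPred_eq, Set.mem_image, Prod.exists, Prod.map_apply, Prod.mk.injEq,
    Perm.mul_apply, swap_inv]
  constructor
  · rintro ⟨h1, h2⟩
    refine ⟨swap v w a, swap v w b, ⟨by rw [← h1]; simp, by simpa [p_swap_apply hp] using h2⟩, ?_⟩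
    simp
  · rintro ⟨a', b', ⟨h1, h2⟩, rfl, rfl⟩
    exact ⟨by simp [h1], by simpa [p_swap_apply hp] using h2⟩

lemma cross_conj_swap_of_notMem_ends {v w : V} (hp : p v = p w) (hv : v ∉ ends (cross p σ))
    (hw : w ∉ ends (cross p σ)) :
    cross p (swap v w * σ * (swap v w)⁻¹) = cross p σ := by
  rw [cross_conj_swap hp]
  have : ∀ q ∈ cross p σ, Prod.map (swap v w) (swap v w) q = q := by
    rintro ⟨a, b⟩ hq
    have h1 : ∀ z, z ∉ ends (cross p σ) → a ≠ z ∧ b ≠ z := fun z hz =>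
      ⟨fun e => hz ⟨_, hq, Or.inl e⟩, fun e => hz ⟨_, hq, Or.inr e⟩⟩
    simp [swap_apply_of_ne_of_ne (h1 v hv).1 (h1 w hw).1,
      swap_apply_of_ne_of_ne (h1 v hv).2 (h1 w hw).2]
  rw [Set.image_congr this, Set.image_id']

/-- A vertex `v` inside a part can be bypassed, if necessary after an exchange of roles with
another such vertex of the same part. -/
lemma IsShape.remove (h : IsShape R p k σ) {v w : V} (hv : σ v ≠ v) (hw : σ w ≠ w)
    (hp : p v = p w) (hvend : v ∉ ends (cross p σ)) (hwend : w ∉ ends (cross p σ))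
    (hw0 : w ≠ v) (hw1 : w ≠ σ v) (hw2 : w ≠ σ (σ v)) :
    ∃ σ', IsShape R p k σ' ∧ cross p σ' = cross p σ ∧ ∀ a, σ' a ≠ a ↔ σ a ≠ a ∧ a ≠ v := by
  -- Only a triangle is an obstacle. Both other vertices of a triangle through `v` are neighbours of
  -- `v` on it, so the triangle lies inside the part.
  by_cases h3 : σ (σ (σ v)) = v
  swap
  · exact ⟨_, h.remove_of_long hv h3 hvend⟩
  have hs : ∀ x, p (swap v w x) = p x := p_swap_apply hp
  have hc := h.conj (swap v w) hs
  have hX := cross_conj_swap_of_notMem_ends hp hvend hwend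
  set τ := swap v w * σ * (swap v w)⁻¹ with hτ
  have tri : ∀ z, σ (σ (σ z)) = z → ∀ y, σ.SameCycle z y →
      y = z ∨ y = σ z ∨ y = σ (σ z) := by
    intro z hz y hy
    have hst : ∀ a, (a = z ∨ a = σ z ∨ a = σ (σ z)) ↔ (σ a = z ∨ σ a = σ z ∨ σ a = σ (σ z)) := by
      intro a
      have e1 : σ a = z ↔ a = σ (σ z) := by
        conv_lhs => rw [← hz]
        exact σ.injective.eq_iff
      have e2 : σ a = σ z ↔ a = z := σ.injective.eq_iff
      have e3 : σ a = σ (σ z) ↔ a = σ z := σ.injective.eq_iff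
      rw [e1, e2, e3]; tauto
    have := SameCycle.rel (σ := σ)
      (E := fun a b => (a = z ∨ a = σ z ∨ a = σ (σ z)) ↔ (b = z ∨ b = σ z ∨ b = σ (σ z)))
      ⟨fun _ => Iff.rfl, fun h => h.symm, fun h h' => h.trans h'⟩ hst hy
    exact this.1 (Or.inl rfl)
  have mono : ∀ z, σ (σ (σ z)) = z → z ∉ ends (cross p σ) → ∀ y, σ.SameCycle z y → p y = p z := by
    intro z hz he y hy
    obtain ⟨h1, h2⟩ := notMem_ends_cross.1 he
    have : σ⁻¹ z = σ (σ z) := by rw [Perm.inv_eq_iff_eq, hz]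
    rcases tri z hz y hy with rfl | rfl | rfl
    · rfl
    · exact h1
    · rw [← this]; exact h2
  -- Were `w` on a triangle too, both triangles would lie inside the same part and hence coincide,
  -- but `w` is off the triangle of `v`. Thus exchanging `v` and `w` puts `v` on a longer cycle.
  have hw3 : σ (σ (σ w)) ≠ w := fun hw3 => by
    have := h.inside v w hv hw (mono v h3 hvend) (mono w hw3 hwend) hp
    rcases tri v h3 w this with e | e | e
    · exact hw0 e
    · exact hw1 e
    · exact hw2 e
  have hfix : ∀ a, τ a ≠ a ↔ σ a ≠ a := by
    intro a
    have : τ a ≠ a ↔ σ (swap v w a) ≠ swap v w a := by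
      rw [hτ]
      simp only [Perm.mul_apply, swap_inv]
      rw [Ne, Ne, swap_apply_eq_iff]
    rw [this]
    by_cases hav : a = v
    · subst hav; simp [hv, hw]
    · by_cases haw : a = w
      · subst haw; simp [hv, hw]
      · rw [swap_apply_of_ne_of_ne hav haw]
  have hτ3 : τ (τ (τ v)) ≠ v := by
    rw [hτ]
    simp only [Perm.mul_apply, swap_inv, swap_apply_self, swap_apply_left]
    rw [Ne, swap_apply_eq_iff, swap_apply_left]
    exact hw3
  obtain ⟨h1, h2, h4⟩ := hc.remove_of_long ((hfix v).2 hv) hτ3 (by rw [hX]; exact hvend)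
  exact ⟨_, h1, h2.trans hX, fun a => by rw [h4, hfix]⟩

/-- The start of an edge leaving a part can be moved to another vertex of the part. -/
lemma IsShape.move (h : IsShape R p k σ) {x x' : V} (hx : p x ≠ p (σ x)) (hp : p x' = p x)
    (hx' : σ x' ≠ x') (hend : x' ∉ ends (cross p σ))
    (hw : p (σ⁻¹ x) ≠ p x → ∃ w, σ w ≠ w ∧ p w = p x ∧ w ∉ ends (cross p σ) ∧
      w ≠ x' ∧ w ≠ σ x' ∧ w ≠ σ (σ x')) :
    ∃ σ', IsShape R p k σ' ∧ (∀ a, σ' a ≠ a ↔ σ a ≠ a) ∧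
      cross p σ' = (fun q => (swap x x' q.1, q.2)) '' cross p σ := by
  have hxx' : x ≠ x' := by
    rintro rfl
    exact hend ⟨(x, σ x), ⟨rfl, hx⟩, Or.inl rfl⟩
  have hxf : σ x ≠ x := fun e => hx (by rw [e])
  -- If the edge into `x` stays inside the part, `x` and `x'` can simply exchange roles: the
  -- outgoing edge is the only crossing edge affected.
  by_cases ht : p (σ⁻¹ x) = p x
  · refine ⟨swap x x' * σ * (swap x x')⁻¹, h.conj _ (p_swap_apply hp.symm), ?_, ?_⟩
    · intro a
      simp only [Perm.mul_apply, swap_inv]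
      rw [Ne, swap_apply_eq_iff]
      by_cases hav : a = x
      · subst hav; simp [hxf, hx']
      · by_cases haw : a = x'
        · subst haw; simp [hxf, hx']
        · rw [swap_apply_of_ne_of_ne hav haw]
    · rw [cross_conj_swap hp.symm]
      refine Set.image_congr ?_
      rintro ⟨a, b⟩ hq
      simp only [Prod.map_apply, Prod.mk.injEq, true_and]
      refine swap_apply_of_ne_of_ne ?_ ?_
      · rintro rfl
        refine hq.2 ?_
        rw [← ht]
        congr 1
        exact (Perm.eq_inv_iff_eq.2 hq.1)
      · rintro rfl
        exact hend ⟨_, hq, Or.inr rfl⟩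
  -- Here the edge into `x` crosses as well and must stay at `x`. So `x'` is bypassed (with the help
  -- of `w`) and reinserted right after `x`, taking over only the outgoing edge.
  · obtain ⟨w, hw0, hwp, hwe, h1, h2, h3⟩ := hw ht
    obtain ⟨τ, hτ, hτX, hτf⟩ := h.remove hx' hw0 (hp.trans hwp.symm) hend hwe h1 h2 h3
    have tx' : τ x' = x' := by
      by_contra hne
      exact ((hτf x').1 hne).2 rfl
    have tx : τ x ≠ x := (hτf x).2 ⟨hxf, hxx'⟩
    refine ⟨τ * swap x x', hτ.insert_after tx' tx hp.symm, fun a => ?_, ?_⟩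
    · rw [apply_mul_swap_ne_iff tx' tx, hτf]
      constructor
      · rintro (h | rfl)
        · exact h.1
        · exact hx'
      · intro ha
        by_cases haw : a = x'
        · exact Or.inr haw
        · exact Or.inl ⟨ha, haw⟩
    · rw [cross_mul_swap hp.symm, hτX]

end Insert

end CliqueCompress

/-! ### Dictionary between cycle covers and permutations. -/

namespace CliqueCompress

open Equiv Equiv.Perm

universe u v

variable {V : Type u} {ι : Type v}

/-- The rotation of a cycle along itself. -/
lemma IsCycleSubgraph.exists_perm {G : SimpleGraph V} {C : G.Subgraph} (hC : IsCycleSubgraph C) :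
    ∃ τ : Perm V, (∀ x ∈ C.verts, C.Adj x (τ x) ∧ τ (τ x) ≠ x) ∧
      (∀ x ∈ C.verts, ∀ y ∈ C.verts, ∃ n : ℕ, (τ ^ n) x = y) ∧
      (∀ e ∈ C.edgeSet, ∃ x ∈ C.verts, s(x, τ x) = e) := by
  classical
  obtain ⟨a, w, hw, rfl⟩ := hC
  -- The support of a closed walk contains the base point at both ends; dropping the first copy
  -- leaves each vertex once, and shifts indices by one.
  set l := w.support.tail with hl
  have hnd : l.Nodup := hw.support_nodup
  have h3 := hw.three_le_length
  have hlen : l.length = w.length := by simp [hl]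
  have hget : ∀ (i : ℕ) (h : i < l.length), l[i] = w.getVert (i + 1) := by
    intro i h
    rw [SimpleGraph.Walk.getVert_eq_support_getElem _ (by omega)]
    simp [hl]
  have hform : ∀ i, i < w.length → l.formPerm (w.getVert i) = w.getVert (i + 1) := by
    intro i hi
    rcases i with _ | i
    · have := l.formPerm_apply_getElem hnd (w.length - 1) (by omega)
      rw [hget, hget] at this
      simp only [hlen, show w.length - 1 + 1 = w.length by omega, Nat.mod_self,
        SimpleGraph.Walk.getVert_length] at this
      simpa using this
    · have := l.formPerm_apply_getElem hnd i (by omega)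
      rw [hget, hget] at this
      simpa [hlen, Nat.mod_eq_of_lt hi] using this
  have hvert : ∀ x, x ∈ w.toSubgraph.verts ↔ ∃ i, i < w.length ∧ w.getVert i = x := by
    intro x
    rw [SimpleGraph.Walk.mem_verts_toSubgraph, SimpleGraph.Walk.mem_support_iff_exists_getVert]
    constructor
    · rintro ⟨i, rfl, hi⟩
      rcases hi.lt_or_eq with h | rfl
      · exact ⟨i, h, rfl⟩
      · exact ⟨0, by omega, by simp⟩
    · rintro ⟨i, hi, rfl⟩
      exact ⟨i, rfl, hi.le⟩
  have hpow : ∀ n i, i < w.length →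
      (l.formPerm ^ n) (w.getVert i) = w.getVert ((i + n) % w.length) := by
    intro n i hi
    induction n with
    | zero => simp [Nat.mod_eq_of_lt hi]
    | succ n ih =>
      rw [pow_succ', Perm.mul_apply, ih, hform _ (Nat.mod_lt _ (by omega)), ← add_assoc,
        Nat.add_mod (i + n) 1]
      have hlt := Nat.mod_lt (i + n) (show w.length > 0 by omega)
      rw [Nat.mod_eq_of_lt (show 1 < w.length by omega)]
      rcases (show (i + n) % w.length + 1 ≤ w.length by omega).lt_or_eq with h | h
      · rw [Nat.mod_eq_of_lt h]
      · rw [h]; simp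
  have hinj : ∀ i j, i < w.length → j < w.length → w.getVert i = w.getVert j → i = j :=
    fun i j hi hj h => hw.getVert_injOn' (by simp; omega) (by simp; omega) h
  refine ⟨l.formPerm, ?_, ?_, ?_⟩
  · intro x hx
    obtain ⟨i, hi, rfl⟩ := (hvert x).1 hx
    refine ⟨?_, ?_⟩
    · rw [hform i hi, SimpleGraph.Walk.toSubgraph_adj_iff]
      exact ⟨i, rfl, hi⟩
    · have := hpow 2 i hi
      rw [pow_two, Perm.mul_apply] at this
      rw [this]
      intro e
      have := hinj _ _ (Nat.mod_lt _ (by omega)) hi e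
      rcases lt_or_ge (i + 2) w.length with h | h
      · rw [Nat.mod_eq_of_lt h] at this; omega
      · rw [Nat.mod_eq_sub_mod h, Nat.mod_eq_of_lt (by omega)] at this; omega
  · intro x hx y hy
    obtain ⟨i, hi, rfl⟩ := (hvert x).1 hx
    obtain ⟨j, hj, rfl⟩ := (hvert y).1 hy
    refine ⟨w.length - i + j, ?_⟩
    rw [hpow _ i hi, show i + (w.length - i + j) = j + w.length by omega, Nat.add_mod_right,
      Nat.mod_eq_of_lt hj]
  · intro e he
    induction e with | _ x y
    rw [SimpleGraph.Subgraph.mem_edgeSet, SimpleGraph.Walk.toSubgraph_adj_iff] at he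
    obtain ⟨i, h, hi⟩ := he
    exact ⟨w.getVert i, (hvert _).2 ⟨i, hi, rfl⟩, by rw [hform i hi, h]⟩

/-- The permutation `σ` rotates every cycle of the family `𝒞` along itself. -/
structure Rotates {G : SimpleGraph V} (𝒞 : Finset G.Subgraph) (σ : Perm V) : Prop where
  adj : ∀ x, G.Adj x (σ x)
  no_two : ∀ x, σ (σ x) ≠ x
  verts : ∀ C ∈ 𝒞, ∀ x ∈ C.verts, ∀ y, y ∈ C.verts ↔ σ.SameCycle x y
  edges : ∀ C ∈ 𝒞, ∀ e, e ∈ C.edgeSet ↔ ∃ x ∈ C.verts, s(x, σ x) = e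

/-- The cycles partition the vertices, so their rotations glue to one map. It preserves each cycle
and is injective on it, hence is bijective by finiteness. -/
lemma IsCycleCover.exists_rotates [Finite V] {G : SimpleGraph V} {𝒞 : Finset G.Subgraph}
    (h : IsCycleCover G 𝒞) : ∃ σ, Rotates 𝒞 σ := by
  choose K hK hKx using h.span
  have huniq : ∀ C ∈ 𝒞, ∀ x ∈ C.verts, K x = C := by
    intro C hC x hx
    by_contra hne
    exact Set.disjoint_left.1 (h.disjoint _ (hK x) _ hC hne) (hKx x) hx
  choose! τ h1 h2 h3 using fun C (hC : C ∈ 𝒞) => (h.isCycle C hC).exists_perm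
  have hmem : ∀ C ∈ 𝒞, ∀ x ∈ C.verts, τ C x ∈ C.verts := fun C hC x hx =>
    C.edge_vert (h1 C hC x hx).1.symm
  set f : V → V := fun x => τ (K x) x with hf
  have hfK : ∀ x, K (f x) = K x := fun x =>
    huniq _ (hK x) _ (hmem _ (hK x) _ (hKx x))
  have hinj : Function.Injective f := by
    intro x y hxy
    have hk : K x = K y := by rw [← hfK x, ← hfK y, hxy]
    simp only [hf, hk] at hxy
    exact (τ (K y)).injective hxy
  set σ : Perm V := Equiv.ofBijective f (Finite.injective_iff_bijective.1 hinj) with hσ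
  have hσC : ∀ C ∈ 𝒞, ∀ x ∈ C.verts, σ x = τ C x := fun C hC x hx => by
    simp only [hσ, Equiv.ofBijective_apply, hf, huniq C hC x hx]
  have hpow : ∀ C ∈ 𝒞, ∀ x ∈ C.verts, ∀ n : ℕ, (σ ^ n) x = (τ C ^ n) x ∧ (τ C ^ n) x ∈ C.verts := by
    intro C hC x hx n
    induction n with
    | zero => simpa using hx
    | succ n ih =>
      rw [pow_succ', Perm.mul_apply, ih.1, pow_succ', Perm.mul_apply, hσC C hC _ ih.2]
      exact ⟨rfl, hmem C hC _ ih.2⟩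
  refine ⟨σ, ⟨?_, ?_, ?_, ?_⟩⟩
  · intro x
    rw [hσC _ (hK x) _ (hKx x)]
    exact (h1 _ (hK x) _ (hKx x)).1.adj_sub
  · intro x
    rw [hσC _ (hK x) _ (hKx x), hσC _ (hK x) _ (hmem _ (hK x) _ (hKx x))]
    exact (h1 _ (hK x) _ (hKx x)).2
  · intro C hC x hx y
    constructor
    · intro hy
      obtain ⟨n, hn⟩ := h2 C hC x hx y hy
      exact ⟨n, by rw [zpow_natCast, (hpow C hC x hx n).1, hn]⟩
    · intro hxy
      obtain ⟨n, rfl⟩ := hxy.exists_nat_pow_eq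
      rw [(hpow C hC x hx n).1]
      exact (hpow C hC x hx n).2
  · intro C hC e
    constructor
    · intro he
      obtain ⟨x, hx, hxe⟩ := h3 C hC e he
      exact ⟨x, hx, by rw [hσC C hC x hx, hxe]⟩
    · rintro ⟨x, hx, rfl⟩
      rw [hσC C hC x hx]
      exact (h1 C hC x hx).1

/-- The cycle of `σ` through `x`, as a subgraph. -/
def orbitSubgraph {G : SimpleGraph V} (σ : Perm V) (hσ : ∀ x, G.Adj x (σ x)) (x : V) :
    G.Subgraph where
  verts := {y | σ.SameCycle x y}
  Adj a b := σ.SameCycle x a ∧ (σ a = b ∨ σ b = a)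
  adj_sub := by
    rintro a b ⟨-, rfl | rfl⟩
    · exact hσ a
    · exact (hσ b).symm
  edge_vert := fun h => h.1
  symm := ⟨by
    rintro a b ⟨h, rfl | rfl⟩
    · exact ⟨sameCycle_apply_right.2 h, Or.inr rfl⟩
    · exact ⟨sameCycle_apply_right.1 h, Or.inl rfl⟩⟩

lemma exists_walk_of_seq {G : SimpleGraph V} (f : ℕ → V) (hf : ∀ n, G.Adj (f n) (f (n + 1)))
    (n : ℕ) : ∃ w : G.Walk (f 0) (f n), w.support = (List.range (n + 1)).map f ∧
      w.edges = (List.range n).map fun i => s(f i, f (i + 1)) := by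
  induction n with
  | zero => exact ⟨SimpleGraph.Walk.nil, by simp, by simp⟩
  | succ n ih =>
    obtain ⟨w, hs, he⟩ := ih
    refine ⟨w.concat (hf n), ?_, ?_⟩
    · rw [SimpleGraph.Walk.support_concat, hs, List.range_succ (n := n + 1)]
      simp
    · rw [SimpleGraph.Walk.edges_concat, he, List.range_succ (n := n)]
      simp

/-- Follow `x, σ x, …` for one minimal period. The hypothesis `h2` is what makes the edges distinct:
otherwise an orbit of length two would traverse one edge back and forth. -/
lemma isCycleSubgraph_orbitSubgraph [Finite V] {G : SimpleGraph V} (σ : Perm V)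
    (hσ : ∀ x, G.Adj x (σ x)) (h2 : ∀ x, σ (σ x) ≠ x) (x : V) :
    IsCycleSubgraph (orbitSubgraph σ hσ x) := by
  set n := Function.minimalPeriod σ x with hn
  have hper : x ∈ Function.periodicPts σ := by
    obtain ⟨m, hm, hm'⟩ := isOfFinOrder_iff_pow_eq_one.1 (isOfFinOrder_of_finite σ)
    exact ⟨m, hm, by rw [Function.IsPeriodicPt, Function.IsFixedPt, Perm.iterate_eq_pow, hm']; rfl⟩
  have hpos : 0 < n := Function.minimalPeriod_pos_of_mem_periodicPts hper
  set f : ℕ → V := fun m => σ^[m] x with hf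
  have hfs : ∀ m, f (m + 1) = σ (f m) := fun m => Function.iterate_succ_apply' _ _ _
  have hinj : ∀ i j, i < n → j < n → f i = f j → i = j := fun i j hi hj h =>
    Function.iterate_injOn_Iio_minimalPeriod hi hj h
  have hfn : f n = f 0 := Function.isPeriodicPt_minimalPeriod σ x
  obtain ⟨w, hs, he⟩ := exists_walk_of_seq (G := G) f (fun m => by rw [hfs]; exact hσ _) n
  have hclass : ∀ y, σ.SameCycle x y ↔ ∃ i, i < n ∧ f i = y := by
    intro y
    constructor
    · intro h
      obtain ⟨m, rfl⟩ := h.exists_nat_pow_eq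
      refine ⟨m % n, Nat.mod_lt _ hpos, ?_⟩
      rw [← Perm.iterate_eq_pow]
      exact Function.iterate_mod_minimalPeriod_eq
    · rintro ⟨i, -, rfl⟩
      exact ⟨i, by rw [zpow_natCast, ← Perm.iterate_eq_pow]⟩
  have hsc : ∀ i, σ.SameCycle x (f i) := fun i =>
    ⟨i, by rw [zpow_natCast, ← Perm.iterate_eq_pow]⟩
  refine ⟨f 0, w.copy rfl hfn, ⟨⟨⟨?_⟩, ?_⟩, ?_⟩, ?_⟩
  · rw [SimpleGraph.Walk.edges_copy, he]
    refine List.Nodup.map_on ?_ List.nodup_range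
    intro i hi j hj hij
    rw [List.mem_range] at hi hj
    rw [hfs, hfs, Sym2.eq_iff] at hij
    rcases hij with ⟨h, -⟩ | ⟨h, h'⟩
    · exact hinj i j hi hj h
    · exact absurd (by rw [← h, h']) (h2 (f j))
  · intro h
    have := congrArg SimpleGraph.Walk.length h
    rw [SimpleGraph.Walk.length_copy, ← SimpleGraph.Walk.length_edges, he] at this
    simp at this
    omega
  · rw [SimpleGraph.Walk.support_copy, hs, List.range_succ_eq_map, List.map_cons, List.tail_cons,
      List.map_map]
    refine List.Nodup.map_on ?_ List.nodup_range
    intro i hi j hj hij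
    rw [List.mem_range] at hi hj
    simp only [Function.comp, Nat.succ_eq_add_one, hfs] at hij
    exact hinj i j hi hj (σ.injective hij)
  · ext a b
    · rw [SimpleGraph.Walk.mem_verts_toSubgraph, SimpleGraph.Walk.support_copy, hs]
      simp only [List.mem_map, List.mem_range]
      constructor
      · rintro ⟨i, -, rfl⟩; exact hsc i
      · intro h
        obtain ⟨i, hi, rfl⟩ := (hclass a).1 h
        exact ⟨i, by omega, rfl⟩
    · rw [← SimpleGraph.Subgraph.mem_edgeSet, SimpleGraph.Walk.mem_edges_toSubgraph,
        SimpleGraph.Walk.edges_copy, he]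
      simp only [List.mem_map, List.mem_range, hfs]
      constructor
      · rintro ⟨i, -, h⟩
        rw [Sym2.eq_iff] at h
        rcases h with ⟨rfl, rfl⟩ | ⟨rfl, rfl⟩
        · exact ⟨hsc i, Or.inl rfl⟩
        · exact ⟨sameCycle_apply_right.2 (hsc i), Or.inr rfl⟩
      · rintro ⟨h, rfl | rfl⟩
        · obtain ⟨i, hi, rfl⟩ := (hclass a).1 h
          exact ⟨i, hi, rfl⟩
        · obtain ⟨i, hi, rfl⟩ := (hclass b).1 (sameCycle_apply_right.1 h)
          exact ⟨i, hi, Sym2.eq_swap⟩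

lemma exists_isCycleCover_rotates [Finite V] {G : SimpleGraph V} {σ : Perm V}
    (hσ : ∀ x, G.Adj x (σ x)) (h2 : ∀ x, σ (σ x) ≠ x) :
    ∃ 𝒞 : Finset G.Subgraph, IsCycleCover G 𝒞 ∧ Rotates 𝒞 σ := by
  classical
  have := Fintype.ofFinite V
  refine ⟨Finset.univ.image (orbitSubgraph σ hσ), ⟨?_, ?_, ?_⟩, ⟨hσ, h2, ?_, ?_⟩⟩
  · simp only [Finset.mem_image, Finset.mem_univ, true_and]
    rintro _ ⟨x, rfl⟩
    exact isCycleSubgraph_orbitSubgraph σ hσ h2 x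
  · simp only [Finset.mem_image, Finset.mem_univ, true_and]
    rintro _ ⟨x, rfl⟩ _ ⟨y, rfl⟩ hne
    rw [Set.disjoint_left]
    intro z (hz : σ.SameCycle x z) (hz' : σ.SameCycle y z)
    have hxy : σ.SameCycle x y := hz.trans hz'.symm
    have hiff : ∀ a, σ.SameCycle x a ↔ σ.SameCycle y a := fun a =>
      ⟨fun h => hxy.symm.trans h, fun h => hxy.trans h⟩
    refine hne ?_
    ext a b
    · exact hiff a
    · exact and_congr_left fun _ => hiff a
  · intro x
    exact ⟨_, Finset.mem_image_of_mem _ (Finset.mem_univ x), SameCycle.refl _ _⟩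
  · simp only [Finset.mem_image, Finset.mem_univ, true_and]
    rintro _ ⟨x, rfl⟩ y (hy : σ.SameCycle x y) z
    exact ⟨fun h => hy.symm.trans h, fun h => hy.trans h⟩
  · simp only [Finset.mem_image, Finset.mem_univ, true_and]
    rintro _ ⟨x, rfl⟩ e
    induction e with | _ a b
    constructor
    · rintro ⟨h, h'⟩
      dsimp only at h h'
      rcases h' with rfl | rfl
      · exact ⟨a, h, rfl⟩
      · exact ⟨b, sameCycle_apply_right.1 h, Sym2.eq_swap⟩
    · rintro ⟨y, hy, h⟩
      rw [Sym2.eq_iff] at h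
      rcases h with ⟨rfl, rfl⟩ | ⟨rfl, rfl⟩
      · exact ⟨hy, Or.inl rfl⟩
      · exact ⟨sameCycle_apply_right.2 hy, Or.inr rfl⟩

/-- Cycles correspond to orbits, and colours count them. Without 2-cycles `x ↦ s(x, σ x)` is
injective, so unoriented edges between two parts are as many as the oriented ones. -/
lemma Rotates.isCanonical_iff [Finite V] {G : SimpleGraph V} {𝒞 : Finset G.Subgraph} {σ : Perm V}
    (hr : Rotates 𝒞 σ) (hc : IsCycleCover G 𝒞) {P : ι → Set V} {p : V → ι}
    (hP : ∀ i x, x ∈ P i ↔ p x = i) (k : ℕ) :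
    (IsCanonical G P 𝒞 ∧ 𝒞.card = k) ↔ IsShape (partGraph G P) p k σ := by
  choose K hK hKx using hc.span
  have huniq : ∀ C ∈ 𝒞, ∀ x ∈ C.verts, K x = C := by
    intro C hC x hx
    by_contra hne
    exact Set.disjoint_left.1 (hc.disjoint _ (hK x) _ hC hne) (hKx x) hx
  have hKs : ∀ x y, K x = K y ↔ σ.SameCycle x y := fun x y => by
    rw [← hr.verts _ (hK x) x (hKx x)]
    exact ⟨fun h => h ▸ hKx y, fun h => (huniq _ (hK x) _ h).symm⟩
  have hne : ∀ C ∈ 𝒞, ∃ x, K x = C := by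
    intro C hC
    obtain ⟨x, w, -, rfl⟩ := hc.isCycle C hC
    exact ⟨x, huniq _ hC _ (by simp)⟩
  have hmem : ∀ C ∈ 𝒞, ∀ x, x ∈ C.verts ↔ K x = C := fun C hC x =>
    ⟨huniq C hC x, fun h => h ▸ hKx x⟩
  have hfix : ∀ x, σ x ≠ x := fun x => (hr.adj x).ne'
  have hinj : Function.Injective fun x => s(x, σ x) := by
    intro x y hxy
    rcases Sym2.eq_iff.1 hxy with ⟨h, -⟩ | ⟨h, h'⟩
    · exact h
    · exact absurd (by rw [← h, h']) (hr.no_two y)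
  have hedges : ∀ i j, ∀ C ∈ 𝒞, edgesBetween G (P i) (P j) ∩ C.edgeSet =
      (fun x => s(x, σ x)) '' {x | K x = C ∧ s(p x, p (σ x)) = s(i, j)} := by
    intro i j C hC
    ext e
    constructor
    · rintro ⟨⟨a, ha, b, hb, hab, rfl⟩, he⟩
      obtain ⟨x, hx, hxe⟩ := (hr.edges C hC _).1 he
      refine ⟨x, ⟨huniq C hC x hx, ?_⟩, hxe⟩
      have := congrArg (Sym2.map p) hxe
      rw [Sym2.map_mk, Sym2.map_mk] at this
      rw [hP] at ha hb
      rw [this, ha, hb]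
    · rintro ⟨x, ⟨hx, hs⟩, rfl⟩
      refine ⟨?_, (hr.edges C hC _).2 ⟨x, (hmem C hC x).2 hx, rfl⟩⟩
      rcases Sym2.eq_iff.1 hs with ⟨h, h'⟩ | ⟨h, h'⟩
      · exact ⟨x, (hP _ _).2 h, σ x, (hP _ _).2 h', hr.adj x, rfl⟩
      · exact ⟨σ x, (hP _ _).2 h', x, (hP _ _).2 h, (hr.adj x).symm, Sym2.eq_swap⟩
  have hsub : ∀ i x, (K x).verts ⊆ P i ↔ ∀ z, σ.SameCycle x z → p z = i := by
    intro i x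
    constructor
    · intro h z hz
      exact (hP _ _).1 (h ((hr.verts _ (hK x) x (hKx x) z).2 hz))
    · intro h z hz
      exact (hP _ _).2 (h z ((hr.verts _ (hK x) x (hKx x) z).1 hz))
  constructor
  · rintro ⟨hcan, rfl⟩
    have hac : ∀ x y, p x ≠ p (σ x) → s(p x, p (σ x)) = s(p y, p (σ y)) → K x = K y := by
      intro x y hx hxy
      refine hcan.across _ _ hx (K x) (hK x) (K y) (hK y) ?_ ?_
      · rw [hedges _ _ _ (hK x)]
        exact ⟨_, x, ⟨rfl, rfl⟩, rfl⟩
      · rw [hedges _ _ _ (hK y)]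
        exact ⟨_, y, ⟨rfl, hxy.symm⟩, rfl⟩
    refine ⟨fun x _ => hr.no_two x, ?_, ?_, ?_, ?_, ?_⟩
    · refine ⟨fun x => 𝒞.equivFin ⟨K x, hK x⟩, fun a => ?_, fun x y _ _ => ?_⟩
      · obtain ⟨x, hx⟩ := hne _ (𝒞.equivFin.symm a).2
        exact ⟨x, hfix x, by simp [hx]⟩
      · rw [← hKs]
        simp
    · intro x y _ _ hx hy hxy
      rw [← hKs]
      refine hcan.inside (p x) _ (hK x) _ (hK y) ((hsub _ x).2 hx) ((hsub _ y).2 ?_)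
      rw [hxy]; exact hy
    · intro x y hx hxy
      exact (hKs x y).1 (hac x y hx hxy)
    · intro e he
      induction e with | _ i j
      rcases Set.eq_empty_or_nonempty {x | s(p x, p (σ x)) = s(i, j)} with h | ⟨x, hx⟩
      · rw [h]; simp
      · have hij : i ≠ j := fun h => he (by simpa using h)
        have hx' : s(p x, p (σ x)) = s(i, j) := hx
        have hxn : p x ≠ p (σ x) := by
          intro e
          rw [← hx'] at he
          exact he (by simpa using e)
        have := hcan.across_le i j hij (K x) (hK x)
        rw [hedges _ _ _ (hK x), Set.ncard_image_of_injective _ hinj] at this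
        refine le_trans (le_of_eq ?_) this
        congr 1
        ext y
        constructor
        · intro hy
          exact ⟨(hac x y hxn (hx'.trans hy.symm)).symm, hy⟩
        · intro hy
          exact hy.2
    · intro x hx
      exact ⟨hx, x, (hP _ _).2 rfl, σ x, (hP _ _).2 rfl, hr.adj x⟩
  · intro h
    refine ⟨⟨?_, ?_, ?_⟩, ?_⟩
    · intro i C hC D hD hCi hDi
      obtain ⟨x, rfl⟩ := hne C hC
      obtain ⟨y, rfl⟩ := hne D hD
      rw [hsub] at hCi hDi
      have hx := hCi x (SameCycle.refl _ _)
      have hy := hDi y (SameCycle.refl _ _)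
      rw [hKs]
      exact h.inside x y (hfix x) (hfix y) (by rwa [hx]) (by rwa [hy]) (hx.trans hy.symm)
    · intro i j hij C hC D hD hCe hDe
      rw [hedges _ _ _ hC] at hCe
      rw [hedges _ _ _ hD] at hDe
      obtain ⟨_, x, ⟨rfl, hx⟩, -⟩ := hCe
      obtain ⟨_, y, ⟨rfl, hy⟩, -⟩ := hDe
      rw [hKs]
      refine h.across x y (fun e => ?_) (hx.trans hy.symm)
      have : (s(i, j) : Sym2 ι).IsDiag := by rw [← hx]; simpa using e
      exact hij (by simpa using this)
    · intro i j hij C hC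
      rw [hedges _ _ _ hC, Set.ncard_image_of_injective _ hinj]
      exact (Set.ncard_le_ncard (fun x hx => hx.2) (Set.toFinite _)).trans
        (h.across_le s(i, j) (by simpa using hij))
    · obtain ⟨c, hcs, hcc⟩ := h.color
      rw [← Fintype.card_fin k, ← Fintype.card_coe]
      choose g hg using hne
      refine Fintype.card_congr (Equiv.ofBijective (fun C : 𝒞 => c (g C.1 C.2)) ⟨?_, ?_⟩)
      · rintro ⟨C, hC⟩ ⟨D, hD⟩ hCD
        have := (hcc _ _ (hfix _) (hfix _)).1 hCD
        rw [← hKs, hg, hg] at this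
        exact Subtype.ext this
      · intro a
        obtain ⟨x, hx, rfl⟩ := hcs a
        exact ⟨⟨K x, hK x⟩, (hcc _ _ (hfix _) (hfix _)).2 ((hKs _ _).1 (hg _ _))⟩

/-- This removes subgraphs from the problem. Adjacency of `x` and `σ x` also forces `σ` to have no
fixed points. -/
theorem hasCanonicalCycleCover_iff [Finite V] {G : SimpleGraph V} {P : ι → Set V} {p : V → ι}
    (hP : ∀ i x, x ∈ P i ↔ p x = i) (k : ℕ) :
    HasCanonicalCycleCover G P k ↔
      ∃ σ : Perm V, IsShape (partGraph G P) p k σ ∧ ∀ x, G.Adj x (σ x) := by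
  constructor
  · rintro ⟨𝒞, hc, hcan⟩
    obtain ⟨σ, hr⟩ := hc.exists_rotates
    exact ⟨σ, (hr.isCanonical_iff hc hP k).1 hcan, hr.adj⟩
  · rintro ⟨σ, h, hσ⟩
    obtain ⟨𝒞, hc, hr⟩ := exists_isCycleCover_rotates hσ fun x => h.no_two x (hσ x).ne'
    exact ⟨𝒞, hc, (hr.isCanonical_iff hc hP k).2 h⟩

end CliqueCompress

/-! ### Restriction to a subset, endpoint counts and exchange of crossing edges. -/

namespace CliqueCompress

open Equiv Equiv.Perm

universe u v

variable {V : Type u} {ι : Type v} {R : SimpleGraph ι} {p : V → ι} {k : ℕ} {σ : Perm V}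

lemma IsShape.of_adj {R' : SimpleGraph ι} (h : IsShape R p k σ)
    (hadj : ∀ x, p x ≠ p (σ x) → R'.Adj (p x) (p (σ x))) : IsShape R' p k σ :=
  ⟨h.no_two, h.color, h.inside, h.across, h.across_le, hadj⟩

/-- Fixed points are invisible to the shape. This allows covers of `G` and of `H` to be compared as
permutations of the same set. -/
lemma isShape_subtypePerm_iff {U : Set V} (hU : ∀ x, σ x ≠ x ↔ x ∈ U)
    (hm : ∀ x, σ x ∈ U ↔ x ∈ U) (hne : ∀ _ : V, Nonempty U) :
    IsShape R (fun x : U => p x) k (σ.subtypePerm hm) ↔ IsShape R p k σ := by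
  classical
  have hfix : ∀ x : U, (σ.subtypePerm hm) x ≠ x := fun x e =>
    (hU x).2 x.2 (by simpa using congrArg Subtype.val e)
  have hfx : ∀ x ∉ U, σ x = x := fun x hx => by
    by_contra h
    exact hx ((hU x).1 h)
  have hcross : ∀ x, p x ≠ p (σ x) → x ∈ U := fun x hx => by
    by_contra h
    exact hx (by rw [hfx x h])
  have hsame : ∀ x y : U, (σ.subtypePerm hm).SameCycle x y ↔ σ.SameCycle x y := fun x y =>
    sameCycle_subtypePerm
  have hcl : ∀ x ∈ U, ∀ y, σ.SameCycle x y → y ∈ U := fun x hx y hxy =>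
    (hU y).1 fun e => (hU x).2 hx (hxy.apply_eq_self_iff.2 e)
  have hmono : ∀ x : U, (∀ z, (σ.subtypePerm hm).SameCycle x z → p z = p x) ↔
      ∀ z, σ.SameCycle x z → p z = p x := fun x =>
    ⟨fun h z hz => h ⟨z, hcl x x.2 z hz⟩ ((hsame _ _).2 hz), fun h z hz => h z ((hsame _ _).1 hz)⟩
  have hcount : ∀ e : Sym2 ι, ¬ e.IsDiag →
      {x : U | s(p x, p ((σ.subtypePerm hm) x : V)) = e}.ncard =
        {x : V | s(p x, p (σ x)) = e}.ncard := by
    intro e he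
    rw [← Set.ncard_image_of_injective _ Subtype.val_injective]
    congr 1
    ext x
    constructor
    · rintro ⟨x, hx, rfl⟩
      exact hx
    · intro hx
      have hx' : s(p x, p (σ x)) = e := hx
      refine ⟨⟨x, hcross x fun e' => he ?_⟩, hx, rfl⟩
      rw [← hx']
      simpa using e'
  constructor
  · intro h
    refine ⟨?_, ?_, ?_, ?_, ?_, ?_⟩
    · intro x hx e
      exact h.no_two ⟨x, (hU x).1 hx⟩ (hfix _) (Subtype.ext e)
    · obtain ⟨c, hc, hcs⟩ := h.color
      -- Colours of fixed points are irrelevant, but a value in `Fin k` is needed; `hne` supplies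
      -- one.
      refine ⟨fun x => if hx : x ∈ U then c ⟨x, hx⟩ else c (hne x).some, fun a => ?_, ?_⟩
      · obtain ⟨x, -, rfl⟩ := hc a
        exact ⟨x, (hU x).2 x.2, by simp⟩
      · intro x y hx hy
        rw [hU] at hx hy
        simp only [hx, hy, dif_pos]
        rw [hcs _ _ (hfix _) (hfix _), hsame]
    · intro x y hx hy hmx hmy hxy
      rw [hU] at hx hy
      exact (hsame ⟨x, hx⟩ ⟨y, hy⟩).1 (h.inside ⟨x, hx⟩ ⟨y, hy⟩ (hfix _) (hfix _)
        ((hmono ⟨x, hx⟩).2 hmx) ((hmono ⟨y, hy⟩).2 hmy) hxy)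
    · intro x y hx hxy
      have hy : p y ≠ p (σ y) := by
        have := (congrArg Sym2.IsDiag hxy).to_iff
        simp only [Sym2.mk_isDiag_iff] at this
        exact fun e => hx (this.2 e)
      exact (hsame ⟨x, hcross x hx⟩ ⟨y, hcross y hy⟩).1 (h.across _ _ hx hxy)
    · intro e he
      rw [← hcount e he]
      exact h.across_le e he
    · intro x hx
      exact h.adj ⟨x, hcross x hx⟩ hx
  · intro h
    refine ⟨?_, ?_, ?_, ?_, ?_, ?_⟩
    · intro x _ e
      exact h.no_two x ((hU x).2 x.2) (congrArg Subtype.val e)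
    · obtain ⟨c, hc, hcs⟩ := h.color
      refine ⟨fun x => c x, fun a => ?_, fun x y _ _ => ?_⟩
      · obtain ⟨x, hx, rfl⟩ := hc a
        exact ⟨⟨x, (hU x).1 hx⟩, hfix _, rfl⟩
      · rw [hcs _ _ ((hU x).2 x.2) ((hU y).2 y.2), hsame]
    · intro x y _ _ hmx hmy hxy
      exact (hsame x y).2 (h.inside x y ((hU x).2 x.2) ((hU y).2 y.2) ((hmono x).1 hmx)
        ((hmono y).1 hmy) hxy)
    · intro x y hx hxy
      exact (hsame x y).2 (h.across x y hx hxy)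
    · intro e he
      exact (hcount e he).le.trans (h.across_le e he)
    · intro x hx
      exact h.adj x hx

lemma ncard_biUnion_le_mul {α β : Type*} [Finite α] (s : Set α) (f : α → Set β) (m : ℕ)
    (hf : ∀ a ∈ s, (f a).ncard ≤ m) : (⋃ a ∈ s, f a).ncard ≤ s.ncard * m := by
  have := Finset.set_ncard_biUnion_le s.toFinite.toFinset f
  simp only [Set.Finite.mem_toFinset] at this
  refine this.trans ?_
  rw [Set.ncard_eq_toFinset_card s, ← smul_eq_mul]
  exact Finset.sum_le_card_nsmul _ _ _ fun a ha => hf a (by simpa using ha)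

/-- Each of the at most `Δ` neighbouring parts accounts for at most two crossing edges, each with a
single endpoint in part `i`. A vertex with two crossing edges is counted twice, which makes the
bound strict. -/
lemma ncard_inter_ends_le_aux [Finite V] [Finite ι] {Δ : ℕ} (h : IsShape R p k σ) (i : ι)
    (hΔ : (R.neighborSet i).ncard ≤ Δ) :
    ({x | p x = i} ∩ ends (cross p σ)).ncard ≤ 2 * Δ ∧
    ∀ x, p x = i → p (σ x) ≠ i → p (σ⁻¹ x) ≠ i →
      ({x | p x = i} ∩ ends (cross p σ)).ncard < 2 * Δ := by
  classical
  set T : Set V := {a | p a ≠ p (σ a) ∧ (p a = i ∨ p (σ a) = i)} with hT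
  have hTle : T.ncard ≤ 2 * Δ := by
    calc T.ncard ≤ (⋃ j ∈ R.neighborSet i, {x | s(p x, p (σ x)) = s(i, j)}).ncard := by
          refine Set.ncard_le_ncard ?_ (Set.toFinite _)
          rintro a ⟨ha, rfl | rfl⟩
          · exact Set.mem_biUnion (h.adj a ha) rfl
          · exact Set.mem_biUnion (h.adj a ha).symm Sym2.eq_swap
      _ ≤ (R.neighborSet i).ncard * 2 :=
          ncard_biUnion_le_mul _ _ _ fun j hj => h.across_le _ (by simpa using hj.ne)
      _ ≤ 2 * Δ := by omega
  set g : V → V := fun a => if p a = i then a else σ a with hg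
  have hsub : {x | p x = i} ∩ ends (cross p σ) ⊆ g '' T := by
    rintro z ⟨hz : p z = i, ⟨a, b⟩, ⟨hab : σ a = b, hp : p a ≠ p b⟩, h' : a = z ∨ b = z⟩
    subst hab
    rcases h' with rfl | rfl
    · exact ⟨a, ⟨hp, Or.inl hz⟩, by simp [hg, hz]⟩
    · exact ⟨a, ⟨hp, Or.inr hz⟩, by rw [hz] at hp; simp [hg, hp]⟩
  refine ⟨(Set.ncard_le_ncard hsub (Set.toFinite _)).trans
    ((Set.ncard_image_le (Set.toFinite _)).trans hTle), fun x hx h1 h2 => ?_⟩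
  have hxT : x ∈ T := ⟨by rw [hx]; exact h1.symm, Or.inl hx⟩
  have hyT : σ⁻¹ x ∈ T := ⟨by simpa [hx] using h2, Or.inr (by simpa using hx)⟩
  have hne : σ⁻¹ x ≠ x := fun e => h2 (by rw [e, hx])
  -- The edge leaving `x` can be discarded, since the edge entering `x` contributes the same
  -- endpoint.
  have hsub' : {x | p x = i} ∩ ends (cross p σ) ⊆ g '' (T \ {x}) := by
    intro z hz
    obtain ⟨a, ha, rfl⟩ := hsub hz
    by_cases hax : a = x
    · subst hax
      exact ⟨σ⁻¹ a, ⟨hyT, hne⟩, by simp only [hg, h2, hx, if_true, if_false]; simp⟩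
    · exact ⟨a, ⟨ha, hax⟩, rfl⟩
  have := (Set.ncard_le_ncard hsub' (Set.toFinite _)).trans (Set.ncard_image_le (Set.toFinite _))
  have h3 := Set.ncard_sdiff_singleton_lt_of_mem hxT (Set.toFinite _)
  omega

lemma IsShape.ncard_inter_ends_le [Finite V] [Finite ι] {Δ : ℕ} (h : IsShape R p k σ) (i : ι)
    (hΔ : (R.neighborSet i).ncard ≤ Δ) : ({x | p x = i} ∩ ends (cross p σ)).ncard ≤ 2 * Δ :=
  (ncard_inter_ends_le_aux h i hΔ).1

lemma IsShape.ncard_inter_ends_lt [Finite V] [Finite ι] {Δ : ℕ} (h : IsShape R p k σ) (i : ι)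
    (hΔ : (R.neighborSet i).ncard ≤ Δ) {x : V} (hx : p x = i) (h1 : p (σ x) ≠ i)
    (h2 : p (σ⁻¹ x) ≠ i) : ({x | p x = i} ∩ ends (cross p σ)).ncard < 2 * Δ :=
  (ncard_inter_ends_le_aux h i hΔ).2 x hx h1 h2

lemma exists_mem_notMem_of_ncard_lt [Finite V] (A F B : Set V)
    (h : (A ∩ F).ncard + B.ncard < A.ncard) : ∃ w ∈ A, w ∉ F ∧ w ∉ B := by
  by_contra! hc
  have hsub : A ⊆ (A ∩ F) ∪ B := fun w hw => by
    by_cases hF : w ∈ F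
    · exact Or.inl ⟨hw, hF⟩
    · exact Or.inr (hc w hw hF)
  have := Set.ncard_le_ncard hsub (Set.toFinite _)
  have := Set.ncard_union_le (A ∩ F) B
  omega

/-- The alternative `x' = x` lets one endpoint of a crossing edge stay while the other is exchanged.
The size of the part matters only when both edges at `x` cross, where an auxiliary vertex is needed.
-/
lemma IsShape.half_move [Finite V] [Finite ι] {Δ : ℕ} (h : IsShape R p k σ)
    (hfull : ∀ x, σ x ≠ x) (hΔ : ∀ i, (R.neighborSet i).ncard ≤ Δ) {x x' : V}
    (hx : p x ≠ p (σ x)) (hp : p x' = p x)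
    (hx' : x' = x ∨ x' ∉ ends (cross p σ) ∧ 6 * Δ ≤ {z | p z = p x}.ncard + 1) :
    ∃ σ', IsShape R p k σ' ∧ (∀ a, σ' a ≠ a) ∧
      cross p σ' = insert (x', σ x) (cross p σ \ {(x, σ x)}) := by
  classical
  have hmem : (x, σ x) ∈ cross p σ := ⟨rfl, hx⟩
  rcases hx' with rfl | ⟨hend, hcard⟩
  · exact ⟨σ, h, hfull, by simp [Set.insert_eq_of_mem hmem]⟩
  have hpos : 0 < Δ := by
    refine lt_of_lt_of_le ?_ (hΔ (p x))
    exact (Set.ncard_pos (Set.toFinite _)).2 ⟨_, h.adj x hx⟩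
  obtain ⟨σ', h1, h2, h3⟩ := h.move hx hp (hfull x') hend (by
    intro ht
    -- At most `2 * Δ - 1` endpoints and three further vertices are forbidden among at least `6 * Δ
    -- - 1`. For `Δ = 1` the strict bound is indispensable.
    have hlt := h.ncard_inter_ends_lt (p x) (hΔ _) rfl hx.symm ht
    have hB : ({x', σ x', σ (σ x')} : Set V).ncard ≤ 3 := by
      refine (Set.ncard_insert_le _ _).trans ?_
      have := Set.ncard_insert_le (σ x') {σ (σ x')}
      rw [Set.ncard_singleton] at this
      omega
    obtain ⟨w, hw, hwF, hwB⟩ := exists_mem_notMem_of_ncard_lt {z | p z = p x} (ends (cross p σ))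
      {x', σ x', σ (σ x')} (by omega)
    simp only [Set.mem_insert_iff, Set.mem_singleton_iff, not_or] at hwB
    exact ⟨w, hfull w, hw, hwF, hwB⟩)
  refine ⟨σ', h1, fun a => (h2 a).2 (hfull a), ?_⟩
  rw [h3]
  ext ⟨a, b⟩
  simp only [Set.mem_image, Set.mem_insert_iff, Set.mem_sdiff, Set.mem_singleton_iff, Prod.mk.injEq,
    Prod.exists]
  have ho : ∀ a b, (a, b) ∈ cross p σ → a ≠ x' := fun a b hab e => hend ⟨_, hab, Or.inl e⟩
  constructor
  · rintro ⟨a', b', hq, rfl, rfl⟩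
    by_cases hax : a' = x
    · subst hax
      exact Or.inl ⟨by simp, hq.1.symm⟩
    · rw [swap_apply_of_ne_of_ne hax (ho _ _ hq)]
      exact Or.inr ⟨hq, fun e => hax e.1⟩
  · rintro (⟨rfl, rfl⟩ | ⟨hq, hne⟩)
    · exact ⟨x, σ x, hmem, by simp, rfl⟩
    · refine ⟨a, b, hq, ?_, rfl⟩
      refine swap_apply_of_ne_of_ne ?_ (ho _ _ hq)
      rintro rfl
      exact hne ⟨rfl, hq.1.symm⟩

/-- An edge between two parts can be exchanged for another one whose new endpoints lie inside
their parts. -/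
lemma IsShape.replace [Finite V] [Finite ι] {Δ : ℕ} (h : IsShape R p k σ)
    (hfull : ∀ x, σ x ≠ x) (hΔ : ∀ i, (R.neighborSet i).ncard ≤ Δ) {x y x' y' : V}
    (hxy : (x, y) ∈ cross p σ) (hpx : p x' = p x) (hpy : p y' = p y)
    (hx' : x' = x ∨ x' ∉ ends (cross p σ) ∧ 6 * Δ ≤ {z | p z = p x}.ncard + 1)
    (hy' : y' = y ∨ y' ∉ ends (cross p σ) ∧ 6 * Δ ≤ {z | p z = p y}.ncard + 1) :
    ∃ σ', IsShape R p k σ' ∧ (∀ a, σ' a ≠ a) ∧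
      cross p σ' ⊆ insert (x', y') (cross p σ \ {(x, y)}) := by
  obtain ⟨hσ, hp⟩ := hxy
  dsimp only at hσ hp
  subst hσ
  obtain ⟨τ, hτ, hτf, hτX⟩ := h.half_move hfull hΔ hp hpx hx'
  have hmem : (x', σ x) ∈ cross p τ := by rw [hτX]; exact Or.inl rfl
  have hinv : τ⁻¹ (σ x) = x' := by rw [Perm.inv_eq_iff_eq]; exact hmem.1.symm
  -- The first half of the exchange creates no endpoint at `y'`: its only new endpoint `x'` is in
  -- another part.
  have hends : y' ∉ ends (cross p σ) → y' ∉ ends (cross p τ⁻¹) := by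
    rw [cross_inv, ends_swap, hτX]
    rintro hn ⟨q, hq | hq, h'⟩
    · subst hq
      rcases h' with h' | h'
      · dsimp at h'
        rw [← h', hpx] at hpy
        exact hp hpy
      · dsimp at h'
        exact hn ⟨(x, σ x), ⟨rfl, hp⟩, Or.inr h'⟩
    · exact hn ⟨q, hq.1, h'⟩
  -- The end of the edge is moved as the start of the reversed edge.
  obtain ⟨ρ, hρ, hρf, hρX⟩ := hτ.inv.half_move (x := σ x) (x' := y')
    (fun a e => hτf a (by rw [Perm.inv_eq_iff_eq] at e; exact e.symm)) hΔ
    (by rw [hinv]; exact hmem.2.symm) hpy (hy'.imp id fun h => ⟨hends h.1, h.2⟩)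
  rw [hinv, cross_inv] at hρX
  refine ⟨ρ⁻¹, hρ.inv, fun a e => hρf a (by rw [Perm.inv_eq_iff_eq] at e; exact e.symm), ?_⟩
  rw [cross_inv, hρX]
  rintro _ ⟨q, hq | ⟨⟨q, hq, rfl⟩, hne⟩, rfl⟩
  · subst hq
    exact Or.inl rfl
  · rw [hτX] at hq
    rcases hq with rfl | hq
    · exact absurd rfl hne
    · exact Or.inr hq

/-! ### Moving crossing edges into `U`, and removing or adding the other vertices. -/

section Sparsify

variable [Finite V] [Finite ι] {Δ : ℕ} {G : SimpleGraph V} {U : Set V}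

/-- All edges between the parts can be moved into the set `U`. -/
lemma IsShape.exists_cross_subset (hΔ : ∀ i, (R.neighborSet i).ncard ≤ Δ)
    (hrep : ∀ F : Set V, (∀ i, ({z | p z = i} ∩ F).ncard ≤ 2 * Δ) → ∀ x y, G.Adj x y →
      p x ≠ p y → ∃ x' y', G.Adj x' y' ∧ p x' = p x ∧ p y' = p y ∧ x' ∈ U ∧ y' ∈ U ∧
        (x' = x ∨ x' ∉ F ∧ 6 * Δ ≤ {z | p z = p x}.ncard + 1) ∧
        (y' = y ∨ y' ∉ F ∧ 6 * Δ ≤ {z | p z = p y}.ncard + 1))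
    (n : ℕ) : ∀ σ : Perm V, IsShape R p k σ → (∀ x, σ x ≠ x) →
      (∀ q ∈ cross p σ, G.Adj q.1 q.2) →
      {q ∈ cross p σ | ¬ (q.1 ∈ U ∧ q.2 ∈ U)}.ncard ≤ n →
      ∃ σ' : Perm V, IsShape R p k σ' ∧ (∀ x, σ' x ≠ x) ∧
        ∀ q ∈ cross p σ', G.Adj q.1 q.2 ∧ q.1 ∈ U ∧ q.2 ∈ U := by
  induction n with
  | zero =>
    intro σ h hf hadj hn
    rw [Nat.le_zero, Set.ncard_eq_zero (Set.toFinite _)] at hn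
    refine ⟨σ, h, hf, fun q hq => ⟨hadj q hq, ?_⟩⟩
    by_contra hc
    exact Set.notMem_empty q (hn ▸ ⟨hq, hc⟩)
  | succ n ih =>
    intro σ h hf hadj hn
    by_cases hgood : ∀ q ∈ cross p σ, q.1 ∈ U ∧ q.2 ∈ U
    · exact ⟨σ, h, hf, fun q hq => ⟨hadj q hq, hgood q hq⟩⟩
    push Not at hgood
    obtain ⟨⟨x, y⟩, hq, hbad⟩ := hgood
    obtain ⟨x', y', hxy', hpx, hpy, hxU, hyU, hx', hy'⟩ := hrep (ends (cross p σ))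
      (fun i => h.ncard_inter_ends_le i (hΔ i)) x y (hadj _ hq) hq.2
    obtain ⟨τ, hτ, hτf, hτX⟩ := h.replace hf hΔ hq hpx hpy hx' hy'
    refine ih τ hτ hτf (fun q hq => ?_) ?_
    · rcases hτX hq with rfl | hq
      · exact hxy'
      · exact hadj q hq.1
    · have hsub : {q ∈ cross p τ | ¬ (q.1 ∈ U ∧ q.2 ∈ U)} ⊆
          {q ∈ cross p σ | ¬ (q.1 ∈ U ∧ q.2 ∈ U)} \ {(x, y)} := by
        rintro q ⟨hq, hqb⟩
        rcases hτX hq with rfl | hq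
        · exact absurd ⟨hxU, hyU⟩ hqb
        · exact ⟨⟨hq.1, hqb⟩, hq.2⟩
      have h1 := Set.ncard_le_ncard hsub (Set.toFinite _)
      have h2 := Set.ncard_sdiff_singleton_lt_of_mem
        (s := {q ∈ cross p σ | ¬ (q.1 ∈ U ∧ q.2 ∈ U)}) (a := (x, y))
        ⟨hq, fun hc => hbad hc.1 hc.2⟩ (Set.toFinite _)
      omega

/-- The vertices outside `U` can be bypassed when no edge between the parts uses them. -/
lemma IsShape.exists_support_eq (hΔ : ∀ i, (R.neighborSet i).ncard ≤ Δ)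
    (hbig : ∀ v ∉ U, 4 * Δ + 3 ≤ ({z | p z = p v} ∩ U).ncard)
    (n : ℕ) : ∀ σ : Perm V, IsShape R p k σ → (∀ x ∈ U, σ x ≠ x) →
      (∀ q ∈ cross p σ, q.1 ∈ U ∧ q.2 ∈ U) → {x | σ x ≠ x ∧ x ∉ U}.ncard ≤ n →
      ∃ σ' : Perm V, IsShape R p k σ' ∧ (∀ x, σ' x ≠ x ↔ x ∈ U) ∧ cross p σ' = cross p σ := by
  classical
  induction n with
  | zero =>
    intro σ h hf _ hn
    rw [Nat.le_zero, Set.ncard_eq_zero (Set.toFinite _)] at hn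
    refine ⟨σ, h, fun x => ⟨fun hx => ?_, hf x⟩, rfl⟩
    by_contra hc
    exact Set.notMem_empty x (hn ▸ ⟨hx, hc⟩)
  | succ n ih =>
    intro σ h hf hX hn
    by_cases hgood : ∀ x, σ x ≠ x → x ∈ U
    · exact ⟨σ, h, fun x => ⟨hgood x, hf x⟩, rfl⟩
    push Not at hgood
    obtain ⟨v, hv, hvU⟩ := hgood
    have hvend : v ∉ ends (cross p σ) := by
      rintro ⟨q, hq, rfl | rfl⟩
      · exact hvU (hX q hq).1
      · exact hvU (hX q hq).2
    have hB : ({σ v, σ (σ v)} : Set V).ncard ≤ 2 := by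
      have := Set.ncard_insert_le (σ v) {σ (σ v)}
      rw [Set.ncard_singleton] at this
      omega
    have hE : ({z | p z = p v} ∩ U ∩ ends (cross p σ)).ncard ≤ 2 * Δ :=
      (Set.ncard_le_ncard (Set.inter_subset_inter_left _ Set.inter_subset_left)
        (Set.toFinite _)).trans
        (h.ncard_inter_ends_le (p v) (hΔ _))
    have hU := hbig v hvU
    -- At most `2 * Δ` endpoints and the two successors of `v` are excluded, fewer than `4 * Δ + 3`.
    -- That `w ≠ v` is automatic as only `w` is in `U`.
    obtain ⟨w, ⟨hwp, hwU⟩, hwF, hwB⟩ := exists_mem_notMem_of_ncard_lt ({z | p z = p v} ∩ U)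
      (ends (cross p σ)) {σ v, σ (σ v)} (by omega)
    simp only [Set.mem_insert_iff, Set.mem_singleton_iff, not_or] at hwB
    obtain ⟨τ, hτ, hτX, hτf⟩ := h.remove hv (hf w hwU) (Eq.symm hwp) hvend hwF
      (fun e => hvU (e ▸ hwU)) hwB.1 hwB.2
    have := ih τ hτ (fun x hx => (hτf x).2 ⟨hf x hx, fun e => hvU (e ▸ hx)⟩)
      (by rw [hτX]; exact hX) ?_
    · rwa [hτX] at this
    · have hsub : {x | τ x ≠ x ∧ x ∉ U} ⊆ {x | σ x ≠ x ∧ x ∉ U} \ {v} := by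
        rintro x ⟨hx, hxU⟩
        exact ⟨⟨((hτf x).1 hx).1, hxU⟩, ((hτf x).1 hx).2⟩
      have h1 := Set.ncard_le_ncard hsub (Set.toFinite _)
      have h2 := Set.ncard_sdiff_singleton_lt_of_mem (s := {x | σ x ≠ x ∧ x ∉ U}) (a := v)
        ⟨hv, hvU⟩ (Set.toFinite _)
      omega

/-- The vertices outside `U` can be inserted into cycles that cover `U`. -/
lemma IsShape.exists_full (hΔ : ∀ i, (R.neighborSet i).ncard ≤ Δ)
    (hbig : ∀ v ∉ U, 4 * Δ + 3 ≤ ({z | p z = p v} ∩ U).ncard)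
    (n : ℕ) : ∀ σ : Perm V, IsShape R p k σ → (∀ x ∈ U, σ x ≠ x) → {x | σ x = x}.ncard ≤ n →
      ∃ σ' : Perm V, IsShape R p k σ' ∧ (∀ x, σ' x ≠ x) ∧ cross p σ' = cross p σ := by
  classical
  induction n with
  | zero =>
    intro σ h _ hn
    rw [Nat.le_zero, Set.ncard_eq_zero (Set.toFinite _)] at hn
    exact ⟨σ, h, fun x hx => Set.notMem_empty x (hn ▸ hx), rfl⟩
  | succ n ih =>
    intro σ h hf hn
    by_cases hgood : ∀ x, σ x ≠ x
    · exact ⟨σ, h, hgood, rfl⟩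
    push Not at hgood
    obtain ⟨v, hv⟩ := hgood
    have hvU : v ∉ U := fun hvU => hf v hvU hv
    have hE : ({z | p z = p v} ∩ U ∩ ends (cross p σ)).ncard ≤ 2 * Δ :=
      (Set.ncard_le_ncard (Set.inter_subset_inter_left _ Set.inter_subset_left)
        (Set.toFinite _)).trans
        (h.ncard_inter_ends_le (p v) (hΔ _))
    have hU := hbig v hvU
    -- Inserting after a vertex on no crossing edge leaves all crossing edges unchanged.
    obtain ⟨x, ⟨hxp, hxU⟩, hxF, -⟩ := exists_mem_notMem_of_ncard_lt ({z | p z = p v} ∩ U)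
      (ends (cross p σ)) ∅ (by simp; omega)
    have hx := hf x hxU
    have hXeq : cross p (σ * swap x v) = cross p σ := by
      rw [cross_mul_swap hxp]
      have : ∀ q ∈ cross p σ, (swap x v q.1, q.2) = q := by
        rintro ⟨a, b⟩ hq
        simp only [Prod.mk.injEq, and_true]
        refine swap_apply_of_ne_of_ne (fun e => hxF ⟨_, hq, Or.inl e⟩) ?_
        rintro rfl
        refine hq.2 ?_
        rw [← hq.1, hv]
      rw [Set.image_congr this, Set.image_id']
    have := ih _ (h.insert_after hv hx hxp)
      (fun y hy => (apply_mul_swap_ne_iff hv hx y).2 (Or.inl (hf y hy))) ?_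
    · rwa [hXeq] at this
    · have hsub : {y | (σ * swap x v) y = y} ⊆ {y | σ y = y} \ {v} := by
        intro y hy
        constructor
        · by_contra hc
          exact (apply_mul_swap_ne_iff hv hx y).2 (Or.inl hc) hy
        · rintro rfl
          exact (apply_mul_swap_ne_iff hv hx y).2 (Or.inr rfl) hy
      have h1 := Set.ncard_le_ncard hsub (Set.toFinite _)
      have h2 := Set.ncard_sdiff_singleton_lt_of_mem (s := {y | σ y = y}) (a := v) hv
        (Set.toFinite _)
      omega

end Sparsify

end CliqueCompress

/-! ### Matchings and the replacement of edges by selected ones. -/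

namespace CliqueCompress

open Equiv Equiv.Perm

universe u v

variable {V : Type u} {ι : Type v} {G : SimpleGraph V} {P : ι → Set V} {Δ : ℕ}

lemma IsKappaPartition.isClique (h : IsKappaPartition G 1 P) (i : ι) : G.IsClique (P i) := by
  obtain ⟨K, hK, hKP⟩ := h.cliques i
  have : ⋃ a, K a = K 0 := Set.ext fun x => by simp
  rw [hKP, this]
  exact hK 0

lemma IsKappaPartition.exists_part {κ : ℕ} (h : IsKappaPartition G κ P) :
    ∃ p : V → ι, ∀ i x, x ∈ P i ↔ p x = i := by
  have hex : ∀ x, ∃ i, x ∈ P i := fun x => by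
    simpa using (h.cover ▸ Set.mem_univ x : x ∈ ⋃ i, P i)
  choose p hp using hex
  refine ⟨p, fun i x => ⟨fun hx => ?_, fun e => e ▸ hp x⟩⟩
  by_contra hne
  exact Set.disjoint_left.1 (h.disjoint hne) (hp x) hx

lemma ncard_le_ncard_of_rel {α β : Type*} [Finite β] {s : Set α} {t : Set β} (r : α → β → Prop)
    (hex : ∀ a ∈ s, ∃ b ∈ t, r a b)
    (hr : ∀ a ∈ s, ∀ a' ∈ s, ∀ b ∈ t, r a b → r a' b → a = a') : s.ncard ≤ t.ncard := by
  choose f hft hfr using hex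
  refine Nat.card_le_card_of_injective (fun a : s => (⟨f a a.2, hft a a.2⟩ : t)) ?_
  rintro ⟨a, ha⟩ ⟨a', ha'⟩ e
  have e' : f a ha = f a' ha' := congrArg Subtype.val e
  exact Subtype.ext (hr a ha a' ha' _ (hft a ha) (hfr a ha) (e' ▸ hfr a' ha'))

lemma edgesBetween_comm (A B : Set V) : edgesBetween G A B = edgesBetween G B A := by
  ext e
  constructor <;> rintro ⟨x, hx, y, hy, h, rfl⟩ <;> exact ⟨y, hy, x, hx, h.symm, Sym2.eq_swap⟩

lemma ncard_endpointsIn_le [Finite V] {A B : Set V} (hAB : Disjoint A B) {M : Set (Sym2 V)}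
    (hM : M ⊆ edgesBetween G A B) : (endpointsIn M A).ncard ≤ M.ncard := by
  refine ncard_le_ncard_of_rel (fun x e => x ∈ e) (fun x hx => hx.2) ?_
  intro x hx y hy e he hxe hye
  obtain ⟨a, ha, b, hb, -, rfl⟩ := hM he
  have : ∀ z ∈ A, z ∈ s(a, b) → z = a := by
    intro z hz hze
    rcases Sym2.mem_iff.1 hze with h | h
    · exact h
    · exact absurd hb (Set.disjoint_left.1 hAB (h ▸ hz))
  rw [this x hx.1 hxe, this y hy.1 hye]

lemma ncard_le_ncard_endpointsIn [Finite V] {A B : Set V} {M : Set (Sym2 V)}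
    (hM : M ⊆ edgesBetween G A B) (hm : IsMatchingSet M) : M.ncard ≤ (endpointsIn M A).ncard := by
  refine ncard_le_ncard_of_rel (fun e x => x ∈ e) (fun e he => ?_) ?_
  · obtain ⟨a, ha, b, hb, -, rfl⟩ := hM he
    exact ⟨a, ⟨ha, _, he, Sym2.mem_mk_left _ _⟩, Sym2.mem_mk_left _ _⟩
  · intro e he f hf x _ hxe hxf
    exact hm e he f hf x hxe hxf

namespace MatchingChoice

variable (S : MatchingChoice G P Δ) {i j : ι}

lemma M'_subset_edgesBetween (h : (partGraph G P).Adj i j) :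
    S.M' i j ⊆ edgesBetween G (P i) (P j) :=
  (S.M'_subset i j h).trans (S.M_maximal i j h).prop.1

lemma isMatchingSet_M' (h : (partGraph G P).Adj i j) : IsMatchingSet (S.M' i j) :=
  fun e he f hf x hxe hxf => (S.M_maximal i j h).prop.2 e (S.M'_subset i j h he) f
    (S.M'_subset i j h hf) x hxe hxf

lemma pairSet_subset (h : (partGraph G P).Adj i j) : S.pairSet i j ⊆ P i := by
  rintro x (hx | ⟨-, y, hy, hx⟩)
  · exact hx.1
  · exact (S.nbrs_subset i j h y hy hx).2

lemma core_subset (i : ι) : S.core i ⊆ P i := by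
  rintro x ⟨j, h, hx⟩
  exact S.pairSet_subset h hx

/-- At most `6 * Δ` endpoints, and `6 * Δ - 1` neighbours for each of at most `6 * Δ` opposite
endpoints, total `36 * Δ ^ 2`. -/
lemma ncard_pairSet_le [Finite V] (hP : Pairwise fun i j => Disjoint (P i) (P j))
    (h : (partGraph G P).Adj i j) : (S.pairSet i j).ncard ≤ 36 * Δ ^ 2 := by
  have hM' : (S.M' i j).ncard ≤ 6 * Δ := (S.M'_ncard i j h).trans_le (min_le_left _ _)
  have h1 : (endpointsIn (S.M' i j) (P i)).ncard ≤ 6 * Δ :=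
    (ncard_endpointsIn_le (hP h.ne) (S.M'_subset_edgesBetween h)).trans hM'
  have h2 : (endpointsIn (S.M' i j) (P j)).ncard ≤ 6 * Δ := by
    refine (ncard_endpointsIn_le (G := G) (hP h.ne') ?_).trans hM'
    rw [edgesBetween_comm]
    exact S.M'_subset_edgesBetween h
  have hsub : S.pairSet i j ⊆ endpointsIn (S.M' i j) (P i) ∪
      ⋃ y ∈ endpointsIn (S.M' i j) (P j), S.nbrs i j y := by
    rintro x (hx | ⟨-, y, hy, hx⟩)
    · exact Or.inl hx
    · exact Or.inr (Set.mem_biUnion hy hx)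
  have h3 : (⋃ y ∈ endpointsIn (S.M' i j) (P j), S.nbrs i j y).ncard ≤
      (endpointsIn (S.M' i j) (P j)).ncard * (6 * Δ - 1) :=
    ncard_biUnion_le_mul _ _ _ fun y hy => (S.nbrs_ncard i j h y hy).trans_le (min_le_right _ _)
  have h4 := (Set.ncard_le_ncard hsub (Set.toFinite _)).trans (Set.ncard_union_le _ _)
  have h5 := Nat.mul_le_mul_right (6 * Δ - 1) h2
  have h6 : 6 * Δ + 6 * Δ * (6 * Δ - 1) = 36 * Δ ^ 2 := by
    rcases Δ with _ | d
    · rfl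
    · rw [show 6 * (d + 1) - 1 = 6 * d + 5 by omega]; ring
  omega

lemma ncard_core_le [Finite V] [Finite ι] (hP : Pairwise fun i j => Disjoint (P i) (P j)) (i : ι)
    (hΔ : ((partGraph G P).neighborSet i).ncard ≤ Δ) : (S.core i).ncard ≤ 36 * Δ ^ 3 := by
  have hsub : S.core i ⊆ ⋃ j ∈ (partGraph G P).neighborSet i, S.pairSet i j := by
    rintro x ⟨j, h, hx⟩
    exact Set.mem_biUnion (show j ∈ (partGraph G P).neighborSet i from h) hx
  calc (S.core i).ncard ≤ _ := Set.ncard_le_ncard hsub (Set.toFinite _)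
    _ ≤ ((partGraph G P).neighborSet i).ncard * (36 * Δ ^ 2) :=
        ncard_biUnion_le_mul _ _ _ fun j hj => S.ncard_pairSet_le hP hj
    _ ≤ Δ * (36 * Δ ^ 2) := Nat.mul_le_mul_right _ hΔ
    _ = 36 * Δ ^ 3 := by ring

/-- A large matching offers an edge that avoids a small set. -/
lemma exists_edge_of_large [Finite V]
    (h : (partGraph G P).Adj i j) (hΔ : 0 < Δ) (hM : 6 * Δ ≤ (S.M i j).ncard) (F : Set V)
    (hi : (P i ∩ F).ncard ≤ 2 * Δ) (hj : (P j ∩ F).ncard ≤ 2 * Δ) :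
    ∃ x ∈ S.core i, ∃ y ∈ S.core j, G.Adj x y ∧ x ∉ F ∧ y ∉ F ∧
      6 * Δ ≤ (P i).ncard ∧ 6 * Δ ≤ (P j).ncard := by
  have hM' : (S.M' i j).ncard = 6 * Δ := (S.M'_ncard i j h).trans (min_eq_left hM)
  have hsub := S.M'_subset_edgesBetween h
  have hmat := S.isMatchingSet_M' h
  have hPi : 6 * Δ ≤ (P i).ncard := hM' ▸ (ncard_le_ncard_endpointsIn hsub hmat).trans
    (Set.ncard_le_ncard (fun _ hx => hx.1) (Set.toFinite _))
  have hPj : 6 * Δ ≤ (P j).ncard := hM' ▸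
    (ncard_le_ncard_endpointsIn (edgesBetween_comm (G := G) _ _ ▸ hsub) hmat).trans
    (Set.ncard_le_ncard (fun _ hx => hx.1) (Set.toFinite _))
  -- Each vertex of `F` blocks at most one edge of a matching, so at most `4 * Δ` of the `6 * Δ`
  -- edges are blocked.
  have hex : ∃ e ∈ S.M' i j, ∀ z ∈ e, z ∉ F := by
    by_contra! hc
    have : (S.M' i j).ncard ≤ ((P i ∩ F) ∪ (P j ∩ F)).ncard := by
      refine ncard_le_ncard_of_rel (fun e x => x ∈ e) (fun e he => ?_)
        fun e he f hf x _ hxe hxf => hmat e he f hf x hxe hxf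
      obtain ⟨z, hz, hzF⟩ := hc e he
      refine ⟨z, ?_, hz⟩
      obtain ⟨a, ha, b, hb, -, rfl⟩ := hsub he
      rcases Sym2.mem_iff.1 hz with rfl | rfl
      · exact Or.inl ⟨ha, hzF⟩
      · exact Or.inr ⟨hb, hzF⟩
    have := Set.ncard_union_le (P i ∩ F) (P j ∩ F)
    omega
  obtain ⟨e, he, heF⟩ := hex
  obtain ⟨a, ha, b, hb, hab, rfl⟩ := hsub he
  refine ⟨a, ⟨j, h, Or.inl ⟨ha, _, he, Sym2.mem_mk_left _ _⟩⟩, b,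
    ⟨i, h.symm, Or.inl ⟨hb, _, ?_, Sym2.mem_mk_right a b⟩⟩, hab, heF _ (Sym2.mem_mk_left _ _),
    heF _ (Sym2.mem_mk_right _ _), hPi, hPj⟩
  rw [S.M'_symm]
  exact he

/-- An endpoint of a small matching has a selected neighbour that avoids a small set. -/
lemma exists_neighbor_of_small [Finite V] (h : (partGraph G P).Adj i j) (hΔ : 0 < Δ)
    (hM : (S.M i j).ncard < 6 * Δ) (F : Set V) (hj : (P j ∩ F).ncard ≤ 2 * Δ) {x y : V}
    (hx : x ∈ endpointsIn (S.M' i j) (P i)) (hy : y ∈ P j) (hxy : G.Adj x y) :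
    ∃ y' ∈ S.core j, G.Adj x y' ∧ (y' = y ∨ y' ∉ F ∧ 6 * Δ ≤ (P j).ncard + 1) := by
  have hx' : x ∈ endpointsIn (S.M' j i) (P i) := by rwa [S.M'_symm]
  have hM' : (S.M j i).ncard < 6 * Δ := by rwa [S.M_symm]
  have hmem : ∀ z ∈ S.nbrs j i x, z ∈ S.core j := fun z hz =>
    ⟨i, h.symm, Or.inr ⟨hM', x, hx', hz⟩⟩
  have hsub := S.nbrs_subset j i h.symm x hx'
  have hcard := S.nbrs_ncard j i h.symm x hx'
  by_cases hyn : y ∈ S.nbrs j i x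
  · exact ⟨y, hmem y hyn, hxy, Or.inl rfl⟩
  -- Since `y` was left out, not all neighbours were chosen; hence exactly `6 * Δ - 1` were, more
  -- than the `2 * Δ` vertices to avoid.
  have hlt : (S.nbrs j i x).ncard < (G.neighborSet x ∩ P j).ncard :=
    Set.ncard_lt_ncard (hsub.ssubset_of_ne fun e => hyn (e ▸ ⟨hxy, hy⟩)) (Set.toFinite _)
  have hcard' : (S.nbrs j i x).ncard = 6 * Δ - 1 := by omega
  have hPj : (S.nbrs j i x).ncard ≤ (P j).ncard :=
    Set.ncard_le_ncard (fun z hz => (hsub hz).2) (Set.toFinite _)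
  have hF : (S.nbrs j i x ∩ F).ncard ≤ (P j ∩ F).ncard :=
    Set.ncard_le_ncard (fun z hz => ⟨(hsub hz.1).2, hz.2⟩) (Set.toFinite _)
  obtain ⟨w, hw, hwF, -⟩ := exists_mem_notMem_of_ncard_lt (S.nbrs j i x) F ∅ (by
    rw [Set.ncard_empty]; omega)
  exact ⟨w, hmem w hw, (hsub hw).1, Or.inr ⟨hwF, by omega⟩⟩

/-- A small matching is selected entirely. An edge missing all of its endpoints could be added to
it, contrary to maximality. -/
lemma mem_endpointsIn_of_small [Finite V] (h : (partGraph G P).Adj i j)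
    (hM : (S.M i j).ncard < 6 * Δ) {x y : V} (hx : x ∈ P i) (hy : y ∈ P j) (hxy : G.Adj x y) :
    x ∈ endpointsIn (S.M' i j) (P i) ∨ y ∈ endpointsIn (S.M' i j) (P j) := by
  have hM' : S.M' i j = S.M i j :=
    Set.eq_of_subset_of_ncard_le (S.M'_subset i j h)
      (by rw [S.M'_ncard i j h, min_eq_right hM.le]) (Set.toFinite _)
  rw [hM']
  by_contra! hc
  obtain ⟨hcx, hcy⟩ := hc
  have hmax := S.M_maximal i j h
  have hfree : ∀ f ∈ S.M i j, ∀ z ∈ f, z ∉ s(x, y) := by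
    intro f hf z hz hzs
    rcases Sym2.mem_iff.1 hzs with rfl | rfl
    · exact hcx ⟨hx, f, hf, hz⟩
    · exact hcy ⟨hy, f, hf, hz⟩
  have hle := hmax.le_of_ge (y := insert s(x, y) (S.M i j))
    ⟨Set.insert_subset ⟨x, hx, y, hy, hxy, rfl⟩ hmax.prop.1, by
      rintro e (rfl | he) f (rfl | hf) z hze hzf
      · rfl
      · exact absurd hze (hfree f hf z hzf)
      · exact absurd hzf (hfree e he z hze)
      · exact hmax.prop.2 e he f hf z hze hzf⟩ (Set.subset_insert _ _)
  exact hcx ⟨hx, _, hle (Set.mem_insert _ _), Sym2.mem_mk_left _ _⟩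

/-- Every edge between two parts can be replaced by an edge between the selected vertices, whose
new endpoints avoid a given small set. -/
lemma exists_replacement [Finite V]
    (h : (partGraph G P).Adj i j) (hΔ : 0 < Δ) (F : Set V)
    (hi : (P i ∩ F).ncard ≤ 2 * Δ) (hj : (P j ∩ F).ncard ≤ 2 * Δ) {x y : V}
    (hx : x ∈ P i) (hy : y ∈ P j) (hxy : G.Adj x y) :
    ∃ x' ∈ S.core i, ∃ y' ∈ S.core j, G.Adj x' y' ∧
      (x' = x ∨ x' ∉ F ∧ 6 * Δ ≤ (P i).ncard + 1) ∧
      (y' = y ∨ y' ∉ F ∧ 6 * Δ ≤ (P j).ncard + 1) := by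
  rcases le_or_gt (6 * Δ) (S.M i j).ncard with hM | hM
  · obtain ⟨a, ha, b, hb, hab, haF, hbF, h1, h2⟩ := S.exists_edge_of_large h hΔ hM F hi hj
    exact ⟨a, ha, b, hb, hab, Or.inr ⟨haF, by omega⟩, Or.inr ⟨hbF, by omega⟩⟩
  · rcases S.mem_endpointsIn_of_small h hM hx hy hxy with hxe | hye
    · obtain ⟨y', hy', hadj, hyy⟩ := S.exists_neighbor_of_small h hΔ hM F hj hxe hy hxy
      exact ⟨x, ⟨j, h, Or.inl hxe⟩, y', hy', hadj, Or.inl rfl, hyy⟩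
    · rw [S.M'_symm] at hye
      rw [S.M_symm] at hM
      obtain ⟨x', hx', hadj, hxx⟩ :=
        S.exists_neighbor_of_small h.symm hΔ hM F hi hye hx hxy.symm
      exact ⟨x', hx', y, ⟨i, h.symm, Or.inl hye⟩, hadj.symm, hxx, Or.inl rfl⟩

end MatchingChoice

/-! ### The sets `U i` and the comparison of `G` with `H`. -/

namespace Selection

variable (S : Selection G P Δ)

lemma U_subset (i : ι) : S.U i ⊆ P i :=
  Set.union_subset (S.core_subset i) fun _ hx => (S.extra_subset i hx).1

/-- The constant is `43 = 36 + 4 + 3`, from the core and the `4 * Δ + 3` extra vertices; `max 1 Δ`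
absorbs the case `Δ = 0`. -/
lemma ncard_U_le [Finite V] [Finite ι] (hP : Pairwise fun i j => Disjoint (P i) (P j)) (i : ι)
    (hΔ : ((partGraph G P).neighborSet i).ncard ≤ Δ) :
    (S.U i).ncard ≤ 43 * max 1 Δ ^ 3 := by
  have h1 := S.ncard_core_le hP i hΔ
  have h2 : (S.extra i).ncard ≤ 4 * Δ + 3 := (S.extra_ncard i).trans_le (min_le_left _ _)
  have h3 : (S.U i).ncard ≤ (S.core i).ncard + (S.extra i).ncard := Set.ncard_union_le _ _
  have h4 : Δ ^ 3 ≤ max 1 Δ ^ 3 := Nat.pow_le_pow_left (le_max_right _ _) 3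
  have h5 : max 1 Δ ≤ max 1 Δ ^ 3 := Nat.le_self_pow (by norm_num) _
  have h6 : Δ ≤ max 1 Δ := le_max_right _ _
  have h7 : 1 ≤ max 1 Δ := le_max_left _ _
  omega

/-- A vertex is left out only if the supply of extra vertices was not exhausted, so the full `4 * Δ
+ 3` were added. -/
lemma le_ncard_U [Finite V] {i : ι} {v : V} (hv : v ∈ P i) (hvU : v ∉ S.U i) :
    4 * Δ + 3 ≤ (S.U i).ncard := by
  have hlt : (S.extra i).ncard < (P i \ S.core i).ncard := by
    refine Set.ncard_lt_ncard ((S.extra_subset i).ssubset_of_ne fun e => hvU (Or.inr ?_))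
      (Set.toFinite _)
    rw [e]
    exact ⟨hv, fun hc => hvU (Or.inl hc)⟩
  have h1 := S.extra_ncard i
  have h2 : (S.extra i).ncard ≤ (S.U i).ncard :=
    Set.ncard_le_ncard Set.subset_union_right (Set.toFinite _)
  omega

variable {p : V → ι}

lemma mem_verts_iff (hP : ∀ i x, x ∈ P i ↔ p x = i) {x : V} : x ∈ S.verts ↔ x ∈ S.U (p x) := by
  constructor
  · intro hx
    obtain ⟨i, hi⟩ := Set.mem_iUnion.1 hx
    rwa [(hP i x).1 (S.U_subset i hi)]
  · exact fun h => Set.mem_iUnion.2 ⟨_, h⟩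

lemma mem_U_iff (hP : ∀ i x, x ∈ P i ↔ p x = i) {i : ι} {x : V} :
    x ∈ S.U i ↔ p x = i ∧ x ∈ S.verts := by
  constructor
  · exact fun h => ⟨(hP i x).1 (S.U_subset i h), Set.mem_iUnion.2 ⟨i, h⟩⟩
  · rintro ⟨rfl, h⟩
    exact (S.mem_verts_iff hP).1 h

/-- Permutations of the subtype are extended by fixed points. The part graphs of `H` and `G` may
differ, so adjacency of joined parts is checked anew in both directions. -/
lemma hasCanonicalCycleCover_H_iff [Finite V] (hP : ∀ i x, x ∈ P i ↔ p x = i)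
    (hne : ∀ _ : V, Nonempty S.verts) (k : ℕ) :
    HasCanonicalCycleCover S.H S.P' k ↔ ∃ σ : Perm V, IsShape (partGraph G P) p k σ ∧
      (∀ x, σ x ≠ x ↔ x ∈ S.verts) ∧ ∀ x ∈ S.verts, G.Adj x (σ x) := by
  classical
  rw [hasCanonicalCycleCover_iff (p := fun x : S.verts => p x) (fun i x => by
    show (x : V) ∈ S.U i ↔ _
    rw [S.mem_U_iff hP]
    simp)]
  constructor
  · rintro ⟨τ, hτ, hadj⟩
    have hmem : ∀ x (hx : x ∈ S.verts), (τ.ofSubtype) x = τ ⟨x, hx⟩ := fun x hx =>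
      Perm.ofSubtype_apply_of_mem τ hx
    have hfix : ∀ x, τ.ofSubtype x ≠ x ↔ x ∈ S.verts := by
      intro x
      constructor
      · intro hx
        by_contra hc
        exact hx (Perm.ofSubtype_apply_of_not_mem τ hc)
      · intro hx
        rw [hmem x hx]
        exact fun e => (hadj ⟨x, hx⟩).ne (Subtype.ext e.symm)
    have hadj' : ∀ x ∈ S.verts, G.Adj x (τ.ofSubtype x) := by
      intro x hx
      rw [hmem x hx]
      exact hadj ⟨x, hx⟩
    have hst : ∀ x, τ.ofSubtype x ∈ S.verts ↔ x ∈ S.verts := fun x => by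
      rw [← hfix, ← hfix, Ne, Ne, (τ.ofSubtype).injective.eq_iff]
    refine ⟨τ.ofSubtype, ?_, hfix, hadj'⟩
    have heq : τ.ofSubtype.subtypePerm hst = τ := by
      ext x
      simp
    rw [← heq] at hτ
    refine ((isShape_subtypePerm_iff hfix hst hne).1 hτ).of_adj fun x hx => ?_
    have hxv : x ∈ S.verts := (hfix x).1 fun e => hx (by rw [e])
    exact ⟨hx, x, (hP _ _).2 rfl, _, (hP _ _).2 rfl, hadj' x hxv⟩
  · rintro ⟨σ, hσ, hfix, hadj⟩
    have hst : ∀ x, σ x ∈ S.verts ↔ x ∈ S.verts := fun x => by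
      rw [← hfix, ← hfix, Ne, Ne, σ.injective.eq_iff]
    refine ⟨σ.subtypePerm hst, ?_, fun x => hadj x x.2⟩
    refine ((isShape_subtypePerm_iff hfix hst hne).2 hσ).of_adj fun x hx => ?_
    exact ⟨hx, x, (S.mem_U_iff hP).2 ⟨rfl, x.2⟩, _, (S.mem_U_iff hP).2 ⟨rfl, Subtype.prop _⟩,
      hadj x x.2⟩

theorem hasCanonicalCycleCover_iff_H [Finite V] [Finite ι] (hK : IsKappaPartition G 1 P)
    (hΔ : ∀ i, ((partGraph G P).neighborSet i).ncard ≤ Δ) (k : ℕ) :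
    HasCanonicalCycleCover G P k ↔ HasCanonicalCycleCover S.H S.P' k := by
  obtain ⟨p, hP⟩ := hK.exists_part
  have hPset : ∀ i, {z | p z = i} = P i := fun i => Set.ext fun z => (hP i z).symm
  have hUset : ∀ i, {z | p z = i} ∩ S.verts = S.U i := fun i => Set.ext fun z =>
    (S.mem_U_iff hP).symm
  have hbig : ∀ v ∉ S.verts, 4 * Δ + 3 ≤ ({z | p z = p v} ∩ S.verts).ncard := by
    intro v hv
    rw [hUset]
    exact S.le_ncard_U ((hP _ _).2 rfl) fun h => hv ((S.mem_verts_iff hP).2 h)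
  have hne : ∀ _ : V, Nonempty S.verts := by
    intro v
    by_cases hv : v ∈ S.verts
    · exact ⟨⟨v, hv⟩⟩
    · have : ({z | p z = p v} ∩ S.verts).Nonempty :=
        (Set.ncard_pos (Set.toFinite _)).1 (by have := hbig v hv; omega)
      exact ⟨⟨_, this.some_mem.2⟩⟩
  have hclique : ∀ x y, p x = p y → x ≠ y → G.Adj x y := fun x y hxy hne' =>
    hK.isClique (p x) ((hP _ _).2 rfl) ((hP _ _).2 hxy.symm) hne'
  -- This is where the parts being cliques enters: only crossing edges need to be watched.
  have hadj : ∀ σ : Perm V, (∀ q ∈ cross p σ, G.Adj q.1 q.2) → ∀ x, σ x ≠ x → G.Adj x (σ x) := by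
    intro σ hX x hx
    by_cases hpx : p x = p (σ x)
    · exact hclique _ _ hpx (Ne.symm hx)
    · exact hX (x, σ x) ⟨rfl, hpx⟩
  have hrep : ∀ F : Set V, (∀ i, ({z | p z = i} ∩ F).ncard ≤ 2 * Δ) → ∀ x y, G.Adj x y →
      p x ≠ p y → ∃ x' y', G.Adj x' y' ∧ p x' = p x ∧ p y' = p y ∧ x' ∈ S.verts ∧ y' ∈ S.verts ∧
        (x' = x ∨ x' ∉ F ∧ 6 * Δ ≤ {z | p z = p x}.ncard + 1) ∧
        (y' = y ∨ y' ∉ F ∧ 6 * Δ ≤ {z | p z = p y}.ncard + 1) := by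
    intro F hF x y hxy hpxy
    have hR : (partGraph G P).Adj (p x) (p y) :=
      ⟨hpxy, x, (hP _ _).2 rfl, y, (hP _ _).2 rfl, hxy⟩
    -- An edge between parts rules out `Δ = 0`, for which nothing needs replacing.
    have hpos : 0 < Δ :=
      ((Set.ncard_pos (Set.toFinite ((partGraph G P).neighborSet (p x)))).2 ⟨_, hR⟩).trans_le
        (hΔ (p x))
    simp only [hPset] at hF ⊢
    obtain ⟨x', hx', y', hy', h1, h2, h3⟩ := S.exists_replacement hR hpos F (hF _)
      (hF _) ((hP _ _).2 rfl) ((hP _ _).2 rfl) hxy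
    have hxU : x' ∈ S.U (p x) := Or.inl hx'
    have hyU : y' ∈ S.U (p y) := Or.inl hy'
    rw [S.mem_U_iff hP] at hxU hyU
    exact ⟨x', y', h1, hxU.1, hyU.1, hxU.2, hyU.2, h2, h3⟩
  rw [hasCanonicalCycleCover_iff hP, S.hasCanonicalCycleCover_H_iff hP hne]
  constructor
  · rintro ⟨σ, hσ, hσadj⟩
    obtain ⟨τ, hτ, hτf, hτX⟩ := IsShape.exists_cross_subset hΔ hrep _ σ hσ
      (fun x => (hσadj x).ne') (fun q hq => hq.1 ▸ hσadj q.1) le_rfl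
    obtain ⟨ρ, hρ, hρf, hρX⟩ := IsShape.exists_support_eq hΔ hbig _ τ hτ (fun x _ => hτf x)
      (fun q hq => (hτX q hq).2) le_rfl
    exact ⟨ρ, hρ, hρf, fun x hx =>
      hadj ρ (by rw [hρX]; exact fun q hq => (hτX q hq).1) x ((hρf x).2 hx)⟩
  · rintro ⟨σ, hσ, hσf, hσadj⟩
    obtain ⟨τ, hτ, hτf, hτX⟩ := IsShape.exists_full hΔ hbig _ σ hσ (fun x hx => (hσf x).2 hx) le_rfl
    refine ⟨τ, hτ, fun x => hadj τ ?_ x (hτf x)⟩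
    rw [hτX]
    rintro q ⟨hq, hp⟩
    rw [← hq] at hp ⊢
    exact hσadj q.1 ((hσf q.1).1 fun e => hp (congrArg p e.symm))

end Selection

end CliqueCompress

theorem mainTheorem11 :
    ∃ c : ℕ, ∀ (V : Type*) [Finite V] (G : SimpleGraph V) (t Δ : ℕ) (P : Fin t → Set V),
      CliqueCompress.IsKappaPartition G 1 P →
      (∀ i, ((CliqueCompress.partGraph G P).neighborSet i).ncard ≤ Δ) →
      ∀ S : CliqueCompress.Selection G P Δ,
        (∀ i, S.U i ⊆ P i ∧ (S.U i).ncard ≤ c * max 1 Δ ^ 3) ∧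
        ∀ k : ℕ, CliqueCompress.HasCanonicalCycleCover G P k ↔
          CliqueCompress.HasCanonicalCycleCover S.H S.P' k :=
  ⟨43, fun _ _ _ _ _ _ hK hΔ S =>
    ⟨fun i => ⟨S.U_subset i, S.ncard_U_le hK.disjoint i (hΔ i)⟩,
      fun k => S.hasCanonicalCycleCover_iff_H hK hΔ k⟩⟩
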